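/- Let $H$ be a separable real Hilbert space and $0<T<\infty$. Let $A^2_H$ be the space of absolutely continuous $u:[0,T]\to H$ with $\dot u\in L^2([0,T];H)$. Let $\varphi:[0,T]\times H\to\mathbb R\cup\{+\infty\}$ be measurable for the $\sigma$-field generated by products of Lebesgue subsets of $[0,T]$ and Borel subsets of $H$, with $\varphi(t,\cdot)$ convex and lower semicontinuous for every $t\in[0,T]$. For $t\in[0,T]$ let $A_t$ be a bounded linear operator on $H$ that is positive, i.e. $\langle A_tx,x\rangle\ge 0$ for all $x\in H$; assume that $t\mapsto\langle A_tx,y\rangle$ is Lebesgue measurable for all $x,y\in H$ and that $t\mapsto\|A_t\|$ is in $L^2[0,T]$. Put $A_t^a=\frac12(A_t-A_t^*)$ and $\psi(t,x)=\varphi(t,x)+\frac12\langle A_tx,x\rangle$, and let $\psi^*(t,\xi)=\sup_{x\in H}\{\langle x,\xi\rangle-\psi(t,x)\}$. Assume that there are exponents $p,q>0$ and positive functions $\beta,\gamma$ on $[0,T]$ with $\beta^{-1},\gamma\in L^\infty[0,T]$ such that $$\beta(t)\|x\|^p\le \varphi(t,x)+\tfrac12\langle A_tx,x\rangle\le\gamma(t)\|x\|^q\qquad\text{for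 all }t\in[0,T],\ x\in H.$$ Then for every $u_0\in H$ the functional $$I(u)=\tfrac12\big(|u(0)|^2+|u(T)|^2\big)-2\langle u(0),u_0\rangle+|u_0|^2+\int_0^T\big[\psi(t,u(t))+\psi^*(t,-A_t^au(t)-\dot u(t))\big]\,dt$$ has a unique minimizer $v$ in $A^2_H$, and $I(v)=\inf_{u\in A^2_H}I(u)=0$. Moreover, among the paths in $A^2_H$, $v$ is the unique solution of $$-A_tv(t)-\dot v(t)\in\partial\varphi(t,v(t))\ \text{ for a.e. } t\in[0,T],\qquad v(0)=u_0,$$ where $\partial\varphi(t,\cdot)$ is the subdifferential of $\varphi(t,\cdot)$. -/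

import Mathlib

open MeasureTheory Set
open scoped ENNReal

noncomputable section

namespace GradientFlow

variable {H : Type*} [NormedAddCommGroup H] [InnerProductSpace ℝ H]

/-- Measurability of `φ : [0,T] × H → [-∞,+∞]` with respect to the product of the Lebesgue
sigma-field of `[0,T]` and the Borel sigma-field of `H`. -/
def LebesgueBorelMeasurable (T : ℝ) (φ : ℝ → H → EReal) : Prop :=
  @Measurable (Icc (0 : ℝ) T × H) EReal
    (@Prod.instMeasurableSpace (Icc (0 : ℝ) T) H
      (MeasurableSpace.comap Subtype.val
        (inferInstance : MeasurableSpace (NullMeasurableSpace ℝ volume)))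
      (borel H))
    inferInstance (fun z => φ (z.1 : ℝ) z.2)

/-- An extended-real-valued function on `H` is convex when its epigraph is convex. -/
def ConvexFun (f : H → EReal) : Prop :=
  Convex ℝ {z : H × ℝ | f z.1 ≤ (z.2 : EReal)}

/-- The Legendre transform `f*(p) = sup_x (⟨x,p⟩ - f x)`. -/
def conj (f : H → EReal) (p : H) : EReal :=
  ⨆ x : H, ((inner ℝ x p : ℝ) : EReal) - f x

/-- The subdifferential of `f` at `x`, empty where `f x` is infinite. -/
def subdiff (f : H → EReal) (x : H) : Set H :=
  {ξ | f x ≠ ⊤ ∧ f x ≠ ⊥ ∧ ∀ y : H, f x + ((inner ℝ ξ (y - x) : ℝ) : EReal) ≤ f y}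

/-- The integral over `[0,T]` of an extended-real-valued function: integral of the positive
part minus integral of the negative part. -/
def eintegral (T : ℝ) (f : ℝ → EReal) : EReal :=
  ((∫⁻ t in Icc (0 : ℝ) T, (f t).toENNReal : ℝ≥0∞) : EReal)
    - ((∫⁻ t in Icc (0 : ℝ) T, (-f t).toENNReal : ℝ≥0∞) : EReal)

/-- The space `A²_H` of absolutely continuous arcs `u : [0,T] → H` with derivative in `L²_H`.
Arcs are represented by functions on `ℝ`, only their values on `[0,T]` matter. -/
def A2 (H : Type*) [NormedAddCommGroup H] [InnerProductSpace ℝ H] (T : ℝ) : Set (ℝ → H) :=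
  {u | AbsolutelyContinuousOnInterval u 0 T ∧
    (∀ᵐ t ∂(volume.restrict (Icc (0 : ℝ) T)), DifferentiableAt ℝ u t) ∧
    MemLp (deriv u) 2 (volume.restrict (Icc (0 : ℝ) T))}

/-- `ψ(t,x) = φ(t,x) + ½⟨A_t x, x⟩`. -/
def psi (φ : ℝ → H → EReal) (A : ℝ → H →L[ℝ] H) (t : ℝ) (x : H) : EReal :=
  φ t x + (((1 / 2 : ℝ) * inner ℝ (A t x) x : ℝ) : EReal)

/-- The antisymmetric part `½(A - A*)`. -/
def antisymmPart [CompleteSpace H] (A : H →L[ℝ] H) : H →L[ℝ] H :=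
  (1 / 2 : ℝ) • (A - ContinuousLinearMap.adjoint A)

/-- The functional
`I(u) = ½(|u(0)|² + |u(T)|²) - 2⟨u(0),u₀⟩ + |u₀|² + ∫₀ᵀ [ψ(t,u) + ψ*(t,-A_tᵃ u - u')] dt`. -/
def action [CompleteSpace H] (T : ℝ) (φ : ℝ → H → EReal) (A : ℝ → H →L[ℝ] H) (u₀ : H)
    (u : ℝ → H) : EReal :=
  (((1 / 2 : ℝ) * (‖u 0‖ ^ 2 + ‖u T‖ ^ 2) - 2 * inner ℝ (u 0) u₀ + ‖u₀‖ ^ 2 : ℝ) : EReal)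
    + eintegral T (fun t =>
        psi φ A t (u t) + conj (psi φ A t) (-(antisymmPart (A t) (u t)) - deriv u t))

/-- `v` solves `-A_t v(t) - v'(t) ∈ ∂φ(t,v(t))` for almost every `t ∈ [0,T]`, `v(0) = u₀`. -/
def IsSolution (T : ℝ) (φ : ℝ → H → EReal) (A : ℝ → H →L[ℝ] H) (u₀ : H) (v : ℝ → H) : Prop :=
  (∀ᵐ t ∂(volume.restrict (Icc (0 : ℝ) T)),
    -(A t (v t)) - deriv v t ∈ subdiff (φ t) (v t)) ∧ v 0 = u₀

end GradientFlow

end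

open MeasureTheory Set Filter Topology
open scoped ENNReal

namespace GradientFlow

/-! ### Absolutely continuous arcs, the energy identity, approximate subgradients -/

section

variable {H : Type*} [NormedAddCommGroup H] [InnerProductSpace ℝ H]

/-! The functional is a sum of two nonnegative defects. The Fenchel inequality gives `ψ(t,x) +
ψ*(t,ξ) ≥ ⟨x,ξ⟩`, and for `ξ = -Aᵃx - w` the antisymmetric part drops out, leaving `-⟨x,w⟩`. Since
`∫ -⟨u,u'⟩ = ½(|u(0)|² - |u(T)|²)`, the boundary terms complete a square and `I(u) ≥ |u(0) - u₀|² ≥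
0` (`FlowData.coe_norm_sq_le_action`). Equality `I(u) = 0` means `u(0) = u₀` together with equality
in Fenchel a.e., i.e. `-Aᵃu - u' ∈ ∂ψ(t,u)`, which is the same as `-Au - u' ∈ ∂φ(t,u)`
(`FlowData.lagrangian_eq_iff`). So the zeros of `I` are exactly the solutions, and monotonicity of
`∂φ + A` leaves room for at most one (`FlowData.solution_unique`).

That the value 0 is attained is shown by solving the equation directly (`FlowData.exists_solution`).
The growth bounds make each `φ(t,·)` finite, continuous and nonnegative, with value 0 at 0 and
bounded on balls uniformly in a.e. `t` (`regular_of_bounds`). Approximate subgradients can then be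
selected measurably from a dense sequence and fed to an explicit Euler scheme. Testing the inclusion
at 0 keeps the approximate arcs in a fixed ball (`FlowData.exists_approximant`); testing two
approximants against each other shows that they form a Cauchy sequence
(`Approximant.norm_sq_sub_le`). Their derivatives share an `L²` majorant, hence have a weak limit,
and the integrated inequality passes to the limit (`FlowData.subgradient_of_weak_limit`). -/

theorem absolutelyContinuousOnInterval_of_dist_le {X Y : Type*} [PseudoMetricSpace X]
    [PseudoMetricSpace Y] {f : ℝ → X} {g : ℝ → Y} {a b : ℝ} (K : ℝ)
    (hf : AbsolutelyContinuousOnInterval f a b)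
    (h : ∀ x ∈ uIcc a b, ∀ y ∈ uIcc a b, dist (g x) (g y) ≤ K * dist (f x) (f y)) :
    AbsolutelyContinuousOnInterval g a b := by
  have h1 : Tendsto (fun E : ℕ × (ℕ → ℝ × ℝ) =>
      K * ∑ i ∈ Finset.range E.1, dist (f (E.2 i).1) (f (E.2 i).2))
      (AbsolutelyContinuousOnInterval.totalLengthFilter ⊓
        𝓟 (AbsolutelyContinuousOnInterval.disjWithin a b)) (𝓝 0) := by
    simpa using Tendsto.const_mul K hf
  refine squeeze_zero' (Eventually.of_forall fun E => Finset.sum_nonneg fun i _ => dist_nonneg)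
    ?_ h1
  filter_upwards [mem_inf_of_right (mem_principal_self _)] with E hE
  rw [Finset.mul_sum]
  exact Finset.sum_le_sum fun i hi => h _ (hE.1 i hi).1 _ (hE.1 i hi).2

/-- Increments are dominated by those of the scalar primitive of `‖v‖`. -/
theorem absolutelyContinuousOnInterval_integral [CompleteSpace H] {v : ℝ → H} {T : ℝ} (u₀ : H)
    (hv : IntervalIntegrable v volume 0 T) :
    AbsolutelyContinuousOnInterval (fun t => u₀ + ∫ s in (0 : ℝ)..t, v s) 0 T := by
  refine absolutelyContinuousOnInterval_of_dist_le 1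
    (hv.norm.absolutelyContinuousOnInterval_intervalIntegral (c := 0) (by simp)) ?_
  intro x hx y hy
  have hx' : IntervalIntegrable v volume 0 x := hv.mono_set (uIcc_subset_uIcc (by simp) hx)
  have hy' : IntervalIntegrable v volume 0 y := hv.mono_set (uIcc_subset_uIcc (by simp) hy)
  rw [dist_add_left, one_mul, dist_eq_norm, dist_eq_norm,
    intervalIntegral.integral_interval_sub_left hx' hy',
    intervalIntegral.integral_interval_sub_left hx'.norm hy'.norm, Real.norm_eq_abs]
  exact intervalIntegral.norm_integral_le_abs_integral_norm

theorem absolutelyContinuousOnInterval_norm_sq {E : Type*} [SeminormedAddCommGroup E]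
    {u : ℝ → E} {a b : ℝ}
    (hu : AbsolutelyContinuousOnInterval u a b) :
    AbsolutelyContinuousOnInterval (fun t => ‖u t‖ ^ 2) a b := by
  obtain ⟨C, hC⟩ := hu.exists_bound
  refine absolutelyContinuousOnInterval_of_dist_le (2 * C) hu ?_
  intro x hx y hy
  rw [Real.dist_eq, dist_eq_norm (u x), sq_sub_sq, abs_mul]
  have h1 : |‖u x‖ + ‖u y‖| ≤ 2 * C := by
    rw [abs_of_nonneg (by positivity)]
    linarith [hC x hx, hC y hy]
  exact mul_le_mul h1 (abs_norm_sub_norm_le _ _) (abs_nonneg _) ((abs_nonneg _).trans h1)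

/-- Energy identity for absolutely continuous arcs. -/
theorem norm_sq_sub_norm_sq_eq_integral {u v : ℝ → H} {T t : ℝ}
    (hu : AbsolutelyContinuousOnInterval u 0 T)
    (hd : ∀ᵐ s ∂(volume.restrict (Icc (0 : ℝ) T)), HasDerivAt u (v s) s)
    (ht : t ∈ Icc (0 : ℝ) T) :
    IntervalIntegrable (fun s => 2 * (inner ℝ (u s) (v s) : ℝ)) volume 0 t ∧
    ‖u t‖ ^ 2 - ‖u 0‖ ^ 2 = ∫ s in (0 : ℝ)..t, 2 * (inner ℝ (u s) (v s) : ℝ) := by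
  have hT : (0 : ℝ) ≤ T := ht.1.trans ht.2
  -- The fundamental theorem of calculus is needed only for the real function `‖u‖²`.
  have hac : AbsolutelyContinuousOnInterval (fun s => ‖u s‖ ^ 2) 0 t :=
    (absolutelyContinuousOnInterval_norm_sq hu).mono
      (uIcc_subset_uIcc (by simp) (by rw [uIcc_of_le hT]; exact ht))
  rw [ae_restrict_iff' measurableSet_Icc] at hd
  have hae : ∀ᵐ s ∂volume, s ∈ uIoc 0 t →
      deriv (fun s => ‖u s‖ ^ 2) s = 2 * (inner ℝ (u s) (v s) : ℝ) := by
    filter_upwards [hd] with s hs hst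
    rw [uIoc_of_le ht.1] at hst
    exact (hs ⟨hst.1.le, hst.2.trans ht.2⟩).norm_sq.deriv
  refine ⟨hac.intervalIntegrable_deriv.congr_ae ?_, ?_⟩
  · rw [EventuallyEq, ae_restrict_iff' measurableSet_uIoc]
    exact hae
  · rw [← hac.integral_deriv_eq_sub]
    exact intervalIntegral.integral_congr_ae hae

theorem hasDerivAt_integral_ae [CompleteSpace H] {v : ℝ → H} {T : ℝ} (hT : 0 ≤ T) (u₀ : H)
    (hv : IntervalIntegrable v volume 0 T) :
    ∀ᵐ s ∂(volume.restrict (Icc (0 : ℝ) T)),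
      HasDerivAt (fun t => u₀ + ∫ s in (0 : ℝ)..t, v s) (v s) s := by
  rw [ae_restrict_iff' measurableSet_Icc]
  filter_upwards [hv.ae_hasDerivAt_integral] with s hs hsT
  rw [uIcc_of_le hT] at hs
  exact (hs hsT 0 ⟨le_rfl, hT⟩).const_add u₀

/-- A continuous convex function has approximate subgradients in any dense sequence. -/
theorem exists_approx_subgradient_mem_denseRange [CompleteSpace H] {f : H → ℝ}
    (hf : ConvexOn ℝ univ f) (hc : Continuous f) {d : ℕ → H} (hd : DenseRange d) (x : H)
    {ε : ℝ} (hε : 0 < ε) :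
    ∃ k, ∀ y, f x + inner ℝ (d k) (y - x) ≤ f y + ε * (1 + ‖y - x‖) := by
  -- An affine minorant of height `f x - ε` at `x` has slope `l` with error `ε`; replacing `l` by a
  -- nearby `d k` costs a further `ε * ‖y - x‖`.
  obtain ⟨l, c, hl, hlc⟩ := hf.exists_affine_le_of_lt (𝕜 := ℝ) (mem_univ x)
    (show f x - ε < f x by linarith) isClosed_univ (hc.lowerSemicontinuous.lowerSemicontinuousOn _)
  obtain ⟨k, hk⟩ := hd.exists_dist_lt ((InnerProductSpace.toDual ℝ H).symm l) hε
  refine ⟨k, fun y => ?_⟩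
  have h1 : l y + c ≤ f y := hl ⟨y, mem_univ y⟩
  have h2 : l x + c = f x - ε := hlc
  have h3 : (inner ℝ ((InnerProductSpace.toDual ℝ H).symm l) (y - x) : ℝ) = l (y - x) :=
    InnerProductSpace.toDual_symm_apply
  have h4 : (inner ℝ (d k - (InnerProductSpace.toDual ℝ H).symm l) (y - x) : ℝ)
      ≤ ε * ‖y - x‖ := by
    refine (real_inner_le_norm _ _).trans ?_
    gcongr
    rw [← dist_eq_norm, dist_comm]
    exact hk.le
  rw [inner_sub_left, h3, map_sub] at h4
  linarith

end

/-! ### Measurable selection, the Euler scheme, weak compactness -/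

section

variable {H : Type*} [NormedAddCommGroup H] [InnerProductSpace ℝ H]

/-- Either `k` is the first index satisfying `P a`, or no index does and `k = 0`, the default value
of `sInf ∅`. -/
theorem nullMeasurable_nat_sInf {α : Type*} [MeasurableSpace α] {μ : Measure α}
    {P : α → ℕ → Prop} (hP : ∀ k, NullMeasurableSet {a | P a k} μ) (k : ℕ) :
    NullMeasurableSet {a | sInf {j | P a j} = k} μ := by
  have h : {a | sInf {j | P a j} = k} =
      ({a | P a k} ∩ ⋂ j ∈ Finset.range k, {a | P a j}ᶜ) ∪
        ({_a | k = 0} ∩ ⋂ j, {a | P a j}ᶜ) := by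
    ext a
    simp only [mem_ofPred_eq, mem_union, mem_inter_iff, mem_iInter, Finset.mem_range, mem_compl_iff]
    constructor
    · rintro rfl
      rcases Set.eq_empty_or_nonempty {j | P a j} with he | hne
      · right
        refine ⟨by rw [he, Nat.sInf_empty], fun j hj => ?_⟩
        have : j ∈ {j | P a j} := hj
        rw [he] at this
        exact this
      · exact Or.inl ⟨Nat.sInf_mem hne, fun j hj h => Nat.notMem_of_lt_sInf hj h⟩
    · rintro (⟨h1, h2⟩ | ⟨rfl, h2⟩)
      · refine le_antisymm (Nat.sInf_le h1) ?_
        by_contra! hlt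
        exact h2 _ hlt (Nat.sInf_mem (s := {j | P a j}) ⟨k, h1⟩)
      · have : {j | P a j} = ∅ := eq_empty_of_forall_notMem h2
        rw [this, Nat.sInf_empty]
  rw [h]
  refine NullMeasurableSet.union ?_ ?_
  · exact (hP k).inter (NullMeasurableSet.biInter (Finset.countable_toSet _)
      fun j _ => (hP j).compl)
  · exact (MeasurableSet.const _).nullMeasurableSet.inter
      (NullMeasurableSet.iInter fun j => (hP j).compl)

theorem aemeasurable_nat_sInf {α : Type*} [MeasurableSpace α] {μ : Measure α}
    {P : α → ℕ → Prop} (hP : ∀ k, NullMeasurableSet {a | P a k} μ) :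
    AEMeasurable (fun a => sInf {j | P a j}) μ := by
  refine NullMeasurable.aemeasurable fun s _ => ?_
  have : (fun a => sInf {j | P a j}) ⁻¹' s = ⋃ k ∈ s, {a | sInf {j | P a j} = k} := by
    ext a; simp
  rw [this]
  exact NullMeasurableSet.biUnion s.to_countable fun k _ => nullMeasurable_nat_sInf hP k

/-- A measurable choice of approximate subgradients of a measurable family of convex functions. -/
theorem exists_measurable_approx_subgradient [CompleteSpace H]
    [TopologicalSpace.SeparableSpace H] {α : Type*} [MeasurableSpace α] {μ : Measure α}
    {f : α → H → ℝ} (hconv : ∀ᵐ t ∂μ, ConvexOn ℝ univ (f t)) (hcont : ∀ᵐ t ∂μ, Continuous (f t))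
    (hmeas : ∀ x, AEMeasurable (fun t => f t x) μ) {ε : ℝ} (hε : 0 < ε) :
    ∃ G : α → H → H, (∀ x, AEStronglyMeasurable (fun t => G t x) μ) ∧
      ∀ᵐ t ∂μ, ∀ x y, f t x + inner ℝ (G t x) (y - x) ≤ f t y + ε * (1 + ‖y - x‖) := by
  set d := TopologicalSpace.denseSeq H
  have hd : DenseRange d := TopologicalSpace.denseRange_denseSeq H
  -- Testing only at the dense points `d j` makes the condition a countable intersection, hence
  -- measurable; continuity of `f t` recovers all `y` at the end.
  let P : H → α → ℕ → Prop := fun x t k =>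
    ∀ j, f t x + inner ℝ (d k) (d j - x) ≤ f t (d j) + ε * (1 + ‖d j - x‖)
  have hP : ∀ x k, NullMeasurableSet {t | P x t k} μ := by
    intro x k
    simp only [P, Set.ofPred_forall]
    exact NullMeasurableSet.iInter fun j =>
      nullMeasurableSet_le ((hmeas x).add_const _) ((hmeas _).add_const _)
  refine ⟨fun t x => d (sInf {k | P x t k}), fun x => ?_, ?_⟩
  · let _ : MeasurableSpace H := borel H
    have : BorelSpace H := ⟨rfl⟩
    exact (measurable_from_nat.comp_aemeasurable (aemeasurable_nat_sInf (hP x))).aestronglyMeasurable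
  · filter_upwards [hconv, hcont] with t h1 h2 x
    have hne : {k | P x t k}.Nonempty := by
      obtain ⟨k, hk⟩ := exists_approx_subgradient_mem_denseRange h1 h2 hd x hε
      exact ⟨k, fun j => hk _⟩
    have hk : P x t (sInf {k | P x t k}) := Nat.sInf_mem hne
    refine fun y => hd.induction_on (p := fun y => f t x +
      inner ℝ (d (sInf {k | P x t k})) (y - x) ≤ f t y + ε * (1 + ‖y - x‖)) y ?_ hk
    exact isClosed_le (by fun_prop) (by fun_prop)

/-- A form of Pettis' theorem: inner products with a dense sequence inject `H` continuously into `ℕ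
→ ℝ`, and a continuous injection of a Polish space is a measurable embedding. -/
theorem aestronglyMeasurable_of_inner [CompleteSpace H] [TopologicalSpace.SeparableSpace H]
    {α : Type*} [MeasurableSpace α] {μ : Measure α} {g : α → H}
    (h : ∀ y : H, AEMeasurable (fun t => (inner ℝ (g t) y : ℝ)) μ) :
    AEStronglyMeasurable g μ := by
  let _ : MeasurableSpace H := borel H
  have : BorelSpace H := ⟨rfl⟩
  set d := TopologicalSpace.denseSeq H
  have hd : DenseRange d := TopologicalSpace.denseRange_denseSeq H
  let Φ : H → ℕ → ℝ := fun x k => inner ℝ x (d k)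
  have hΦ : Continuous Φ := continuous_pi fun k => by fun_prop
  have hinj : Function.Injective Φ := by
    intro x y hxy
    refine ext_inner_right ℝ fun z => ?_
    exact hd.induction_on (p := fun z => (inner ℝ x z : ℝ) = inner ℝ y z) z
      (isClosed_eq (by fun_prop) (by fun_prop)) fun k => congrFun hxy k
  have hemb : MeasurableEmbedding Φ := hΦ.measurableEmbedding hinj
  have hcomp : AEMeasurable (Φ ∘ g) μ := aemeasurable_pi_iff.2 fun k => h (d k)
  exact ((hemb.aemeasurable_comp_iff).1 hcomp).aestronglyMeasurable

theorem aestronglyMeasurable_comp_countable {E α ι : Type*} [TopologicalSpace E]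
    [TopologicalSpace.PseudoMetrizableSpace E] [MeasurableSpace α]
    {μ : Measure α} [MeasurableSpace ι] [Countable ι] [MeasurableSingletonClass ι]
    {F : α → ι → E} (hF : ∀ i, AEStronglyMeasurable (fun t => F t i) μ) {k : α → ι}
    (hk : Measurable k) : AEStronglyMeasurable (fun t => F t (k t)) μ := by
  have hU : (⋃ i, k ⁻¹' {i}) = univ := by ext a; simp
  rw [← Measure.restrict_univ (μ := μ), ← hU, aestronglyMeasurable_iUnion_iff]
  intro i
  refine ((hF i).restrict (s := k ⁻¹' {i})).congr ?_
  rw [EventuallyEq, ae_restrict_iff' (hk (measurableSet_singleton i))]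
  refine Eventually.of_forall fun t ht => ?_
  simp only [mem_preimage, mem_singleton_iff] at ht
  rw [ht]

/-- The explicit Euler scheme of step `h` for a bounded measurable field. -/
theorem exists_euler_scheme [CompleteSpace H] {F : ℝ → H → H} {m : ℝ → ℝ}
    (hF : ∀ x, AEStronglyMeasurable (fun s => F s x) volume)
    (hm : Integrable m volume) (hFm : ∀ᵐ s, ∀ x, ‖F s x‖ ≤ m s) (u₀ : H) {h : ℝ} (hh : 0 < h) :
    ∃ a : ℝ → H, AEStronglyMeasurable a volume ∧
      AEStronglyMeasurable (fun s => F s (a s)) volume ∧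
      ∀ s, 0 ≤ s → ∃ r, 0 ≤ r ∧ r ≤ s ∧ s - r ≤ h ∧
        a s = u₀ + ∫ τ in (0 : ℝ)..r, F τ (a τ) := by
  -- The field is only measurable in time, so each step freezes the space variable and integrates in
  -- `s`, instead of evaluating the field at a node.
  let x : ℕ → H := fun k => Nat.rec u₀
    (fun k y => y + ∫ s in (k * h)..((k + 1 : ℕ) * h), F s y) k
  have hx : ∀ k, x (k + 1) = x k + ∫ s in (k * h)..((k + 1 : ℕ) * h), F s (x k) := fun k => rfl
  let κ : ℝ → ℕ := fun s => ⌊s / h⌋₊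
  have hκ : Measurable κ := Nat.measurable_floor.comp (measurable_id.div_const h)
  let a : ℝ → H := fun s => x (κ s)
  have ha : AEStronglyMeasurable a volume :=
    aestronglyMeasurable_comp_countable (F := fun _ k => x k)
      (fun k => aestronglyMeasurable_const) hκ
  have hFa : AEStronglyMeasurable (fun s => F s (a s)) volume :=
    aestronglyMeasurable_comp_countable (F := fun s k => F s (x k)) (fun k => hF (x k)) hκ
  have hint : Integrable (fun s => F s (a s)) volume :=
    hm.mono' hFa (hFm.mono fun s hs => hs _)
  have hxk : ∀ k : ℕ, x k = u₀ + ∫ τ in (0 : ℝ)..(k * h), F τ (a τ) := by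
    intro k
    induction k with
    | zero => simp [x]
    | succ k ih =>
      rw [hx k, ← intervalIntegral.integral_add_adjacent_intervals (b := (k : ℝ) * h)
        hint.intervalIntegrable hint.intervalIntegrable, ← add_assoc, ← ih]
      congr 1
      have hle : (k : ℝ) * h ≤ ((k + 1 : ℕ) : ℝ) * h := by
        push_cast; nlinarith
      refine intervalIntegral.integral_congr_ae ?_
      -- At the right end-point the floor has already jumped to `k + 1`; this null set is discarded.
      have hne : ∀ᵐ s : ℝ, s ≠ ((k + 1 : ℕ) : ℝ) * h := by simp [ae_iff, measure_singleton]
      filter_upwards [hne] with s hs hsm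
      rw [uIoc_of_le hle] at hsm
      have : κ s = k := by
        rw [Nat.floor_eq_iff (div_nonneg (le_trans (by positivity) hsm.1.le) hh.le)]
        have h2 : s < ((k + 1 : ℕ) : ℝ) * h := lt_of_le_of_ne hsm.2 hs
        push_cast at h2
        exact ⟨(le_div_iff₀ hh).2 hsm.1.le, (div_lt_iff₀ hh).2 h2⟩
      simp only [a, this]
  refine ⟨a, ha, hFa, fun s hs => ⟨κ s * h, by positivity, ?_, ?_, hxk _⟩⟩
  · exact (le_div_iff₀ hh).1 (Nat.floor_le (div_nonneg hs hh.le))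
  · have := (div_lt_iff₀ hh).1 (Nat.lt_floor_add_one (s / h))
    simp only [κ]
    linarith

/-- Bounded sequences in a Hilbert space converge weakly along any ultrafilter. -/
theorem exists_weak_limit {E : Type*} [NormedAddCommGroup E] [InnerProductSpace ℝ E]
    [CompleteSpace E] {ι : Type*} (l : Ultrafilter ι) {v : ι → E} {C : ℝ} (hv : ∀ n, ‖v n‖ ≤ C) :
    ∃ ξ : E, ∀ w : E, Tendsto (fun n => (inner ℝ (v n) w : ℝ)) l (𝓝 (inner ℝ ξ w)) := by
  let Φ : ι → WeakDual ℝ E := fun n => StrongDual.toWeakDual (InnerProductSpace.toDual ℝ E (v n))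
  -- Banach–Alaoglu; an ultrafilter on a compact set converges, so no subsequence is extracted.
  have hK := WeakDual.isCompact_closedBall (𝕜 := ℝ) (E := E) 0 C
  obtain ⟨z, -, hz⟩ := hK.ultrafilter_le_nhds (l.map Φ) (by
    rw [le_principal_iff]
    refine Eventually.of_forall (f := (l : Filter ι)) fun n => ?_
    simpa [Φ] using hv n)
  refine ⟨(InnerProductSpace.toDual ℝ E).symm (WeakDual.toStrongDual z), fun w => ?_⟩
  have h1 : Tendsto (fun n => Φ n w) l (𝓝 (z w)) :=
    ((WeakDual.eval_continuous w).tendsto z).comp hz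
  rw [InnerProductSpace.toDual_symm_apply]
  exact h1

end

/-! ### Approximate solutions: a priori bound and Cauchy estimate -/

section

variable {H : Type*} [NormedAddCommGroup H] [InnerProductSpace ℝ H]

/-- The real-valued data `(f, A)` of an evolution `-A_t u - u' ∈ ∂f(t,u)` on `[0,T]`. -/
structure FlowData (T : ℝ) (f : ℝ → H → ℝ) (A : ℝ → H →L[ℝ] H) : Prop where
  convex : ∀ t ∈ Icc (0 : ℝ) T, ConvexOn ℝ univ (f t)
  cont : ∀ t ∈ Icc (0 : ℝ) T, Continuous (f t)
  zero : ∀ t ∈ Icc (0 : ℝ) T, f t 0 = 0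
  nonneg : ∀ t ∈ Icc (0 : ℝ) T, ∀ x, 0 ≤ f t x
  bdd : ∀ R : ℝ, ∃ C : ℝ, ∀ᵐ t ∂(volume.restrict (Icc (0 : ℝ) T)), ∀ x, ‖x‖ ≤ R → f t x ≤ C
  meas : ∀ x, AEMeasurable (fun t => f t x) (volume.restrict (Icc (0 : ℝ) T))
  pos : ∀ t ∈ Icc (0 : ℝ) T, ∀ x : H, 0 ≤ (inner ℝ (A t x) x : ℝ)
  meas_op : ∀ x y : H, AEMeasurable (fun t => (inner ℝ (A t x) y : ℝ))
    (volume.restrict (Icc (0 : ℝ) T))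
  memLp_op : MemLp (fun t => ‖A t‖) 2 (volume.restrict (Icc (0 : ℝ) T))

/-- Test at distance one from `x` in the direction of `g`: the slope `‖g‖` is at most the increment
of `f` plus `2ε`. -/
theorem norm_le_of_approx_subgradient {f : H → ℝ} {g x : H} {C ε R : ℝ} (hC : 0 ≤ C)
    (hε : 0 ≤ ε) (hx : ‖x‖ ≤ R) (hf : 0 ≤ f x) (hfC : ∀ y, ‖y‖ ≤ R + 1 → f y ≤ C)
    (hg : ∀ y, f x + inner ℝ g (y - x) ≤ f y + ε * (1 + ‖y - x‖)) : ‖g‖ ≤ C + 2 * ε := by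
  rcases eq_or_ne g 0 with rfl | hg0
  · rw [norm_zero]; positivity
  have hn : ‖g‖ ≠ 0 := norm_ne_zero_iff.2 hg0
  have h1 : ‖(‖g‖⁻¹ • g : H)‖ = 1 := by
    rw [norm_smul, norm_inv, norm_norm, inv_mul_cancel₀ hn]
  have h := hg (x + ‖g‖⁻¹ • g)
  rw [add_sub_cancel_left, h1, real_inner_smul_right, real_inner_self_eq_norm_sq] at h
  have h2 : ‖g‖⁻¹ * ‖g‖ ^ 2 = ‖g‖ := by field_simp
  have h3 := hfC (x + ‖g‖⁻¹ • g) ((norm_add_le _ _).trans (by rw [h1]; linarith))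
  rw [h2] at h
  linarith

section

variable [CompleteSpace H] [TopologicalSpace.SeparableSpace H] {T : ℝ} {f : ℝ → H → ℝ}
  {A : ℝ → H →L[ℝ] H}

theorem FlowData.aestronglyMeasurable_op (D : FlowData T f A) (x : H) :
    AEStronglyMeasurable (fun t => A t x) (volume.restrict (Icc (0 : ℝ) T)) :=
  aestronglyMeasurable_of_inner (D.meas_op x)

/-- Truncated measurable selections of approximate subgradients, with a common bound. -/
theorem FlowData.exists_field (D : FlowData T f A) {R : ℝ} (hR : 0 ≤ R) :
    ∃ m : ℝ → ℝ, Integrable m volume ∧ MemLp m 2 (volume.restrict (Icc (0 : ℝ) T)) ∧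
      (∀ s, 0 ≤ m s) ∧ ∀ ε, 0 < ε → ε ≤ 1 → ∃ F : ℝ → H → H,
        (∀ x, AEStronglyMeasurable (fun s => F s x) volume) ∧
        (∀ᵐ s, ∀ x, ‖F s x‖ ≤ m s) ∧
        (∀ s x, R < ‖x‖ → F s x = 0) ∧
        ∀ᵐ s ∂(volume.restrict (Icc (0 : ℝ) T)), ∀ x, ‖x‖ ≤ R → ∀ y,
          f s x + inner ℝ (-(F s x) - A s x) (y - x) ≤ f s y + ε * (1 + ‖y - x‖) := by
  -- The radius `R + 1` leaves room for the unit test step in `norm_le_of_approx_subgradient`. As `ε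
  -- ≤ 1`, the subgradient is bounded by `|C| + 2` and the operator term by `R * ‖A s‖`, which is in
  -- `L²`.
  obtain ⟨C, hC⟩ := D.bdd (R + 1)
  have hmem : MemLp (fun s => (|C| + 2) + R * ‖A s‖) 2 (volume.restrict (Icc (0 : ℝ) T)) := by
    have h1 : MemLp (fun _ : ℝ => |C| + 2) 2 (volume.restrict (Icc (0 : ℝ) T)) := memLp_const _
    have h2 : MemLp (fun s => R * ‖A s‖) 2 (volume.restrict (Icc (0 : ℝ) T)) :=
      D.memLp_op.const_mul R
    exact h1.add h2
  have hin : ∀ᵐ s ∂(volume.restrict (Icc (0 : ℝ) T)), s ∈ Icc (0 : ℝ) T :=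
    ae_restrict_mem measurableSet_Icc
  refine ⟨(Icc (0 : ℝ) T).indicator fun s => (|C| + 2) + R * ‖A s‖, ?_, ?_, ?_, ?_⟩
  · rw [integrable_indicator_iff measurableSet_Icc]
    exact hmem.integrable (by norm_num)
  · refine hmem.ae_eq ?_
    filter_upwards [hin] with s hs
    rw [indicator_of_mem hs]
  · exact fun s => indicator_nonneg (fun s _ => by positivity) s
  intro ε hε hε1
  obtain ⟨G, hG, hGs⟩ := exists_measurable_approx_subgradient
    (hin.mono fun t ht => D.convex t ht) (hin.mono fun t ht => D.cont t ht) D.meas hε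
  have hFin : ∀ᵐ s ∂(volume.restrict (Icc (0 : ℝ) T)), ∀ x, ‖x‖ ≤ R →
      ‖-(G s x) - A s x‖ ≤ (|C| + 2) + R * ‖A s‖ := by
    filter_upwards [hGs, hC, hin] with s h1 h2 h3 x hx
    have h4 : ‖G s x‖ ≤ |C| + 2 * ε := norm_le_of_approx_subgradient (abs_nonneg C) hε.le hx
      (D.nonneg s h3 x) (fun y hy => (h2 y hy).trans (le_abs_self C)) (h1 x)
    have h5 : ‖A s x‖ ≤ R * ‖A s‖ := by
      rw [mul_comm]
      exact (A s).le_opNorm_of_le hx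
    refine (norm_sub_le _ _).trans ?_
    rw [norm_neg]
    linarith
  refine ⟨fun s x => (Icc (0 : ℝ) T).indicator
    (fun s => if ‖x‖ ≤ R then -(G s x) - A s x else 0) s, fun x => ?_, ?_, ?_, ?_⟩
  · rw [aestronglyMeasurable_indicator_iff measurableSet_Icc]
    split_ifs
    · exact (hG x).neg.sub (D.aestronglyMeasurable_op x)
    · exact aestronglyMeasurable_const
  · rw [ae_restrict_iff' measurableSet_Icc] at hFin
    filter_upwards [hFin] with s hs x
    by_cases hsT : s ∈ Icc (0 : ℝ) T
    · rw [indicator_of_mem hsT, indicator_of_mem hsT]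
      split_ifs with hx
      · exact hs hsT x hx
      · rw [norm_zero]; positivity
    · rw [indicator_of_notMem hsT, indicator_of_notMem hsT, norm_zero]
  · intro s x hx
    beta_reduce
    by_cases hsT : s ∈ Icc (0 : ℝ) T
    · rw [indicator_of_mem hsT, if_neg (not_le.2 hx)]
    · rw [indicator_of_notMem hsT]
  · filter_upwards [hGs, hin] with s h1 hsT x hx y
    rw [indicator_of_mem hsT, if_pos hx]
    have : -(-(G s x) - A s x) - A s x = G s x := by abel
    rw [this]
    exact h1 x y

/-- An approximate solution: `a` is a piecewise frozen version of `u₀ + ∫ v`, and `v` satisfies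
the inclusion at `a` up to `δ`. -/
structure Approximant (T : ℝ) (f : ℝ → H → ℝ) (A : ℝ → H →L[ℝ] H) (u₀ : H) (R : ℝ)
    (m : ℝ → ℝ) (δ : ℝ) (a v : ℝ → H) : Prop where
  meas_frozen : AEStronglyMeasurable a volume
  meas_deriv : AEStronglyMeasurable v volume
  bound : ∀ᵐ s, ‖v s‖ ≤ m s
  dist_le : ∀ s ∈ Icc (0 : ℝ) T, ‖a s - (u₀ + ∫ τ in (0 : ℝ)..s, v τ)‖ ≤ δ
  frozen_le : ∀ s ∈ Icc (0 : ℝ) T, ‖a s‖ ≤ R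
  subgrad : ∀ᵐ s ∂(volume.restrict (Icc (0 : ℝ) T)), ∀ y,
    f s (a s) + inner ℝ (-(v s) - A s (a s)) (y - a s) ≤ f s y + δ * (1 + ‖y - a s‖)

/-- Fixes the Euler step: an arc with speed at most `m` drifts by at most `δ` within one step. -/
theorem exists_pos_forall_integral_le {m : ℝ → ℝ} (hm : Integrable m volume) (T : ℝ) {δ : ℝ}
    (hδ : 0 < δ) : ∃ h > 0, ∀ r s, 0 ≤ r → r ≤ s → s ≤ T → s - r ≤ h →
      ∫ τ in r..s, m τ ≤ δ := by
  have hc : UniformContinuousOn (fun t => ∫ τ in (0 : ℝ)..t, m τ) (Icc 0 T) :=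
    isCompact_Icc.uniformContinuousOn_of_continuous
      (intervalIntegral.continuous_primitive (fun _ _ => hm.intervalIntegrable) 0).continuousOn
  obtain ⟨h, hh, H'⟩ := Metric.uniformContinuousOn_iff.1 hc δ hδ
  refine ⟨h / 2, by positivity, fun r s h0 hrs hsT hsr => ?_⟩
  have := H' s ⟨h0.trans hrs, hsT⟩ r ⟨h0, hrs.trans hsT⟩ (by
    rw [Real.dist_eq, abs_of_nonneg (by linarith)]; linarith)
  rw [Real.dist_eq, intervalIntegral.integral_interval_sub_left hm.intervalIntegrable
    hm.intervalIntegrable] at this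
  exact (le_abs_self _).trans this.le

omit [TopologicalSpace.SeparableSpace H] in
/-- Growth of the norm of an arc whose derivative is dissipative up to `k`. -/
theorem norm_sq_integral_le {v : ℝ → H} {k : ℝ → ℝ} {u₀ : H} {t : ℝ} (ht : t ∈ Icc (0 : ℝ) T)
    (hv : Integrable v volume) (hk : IntervalIntegrable k volume 0 T)
    (hk0 : ∀ s, 0 ≤ k s)
    (h : ∀ᵐ s ∂(volume.restrict (Icc (0 : ℝ) T)),
      (inner ℝ (u₀ + ∫ τ in (0 : ℝ)..s, v τ) (v s) : ℝ) ≤ k s) :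
    ‖u₀ + ∫ τ in (0 : ℝ)..t, v τ‖ ^ 2 ≤ ‖u₀‖ ^ 2 + 2 * ∫ s in (0 : ℝ)..T, k s := by
  have hT := ht.1.trans ht.2
  obtain ⟨h1, h2⟩ := norm_sq_sub_norm_sq_eq_integral
    (absolutelyContinuousOnInterval_integral u₀ (hv.intervalIntegrable (a := 0) (b := T)))
    (hasDerivAt_integral_ae hT u₀ hv.intervalIntegrable) ht
  have hkt : IntervalIntegrable k volume 0 t :=
    hk.mono_set (uIcc_subset_uIcc (by simp) (by rw [uIcc_of_le hT]; exact ht))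
  have h3 : ∫ s in (0 : ℝ)..t, 2 * (inner ℝ (u₀ + ∫ τ in (0 : ℝ)..s, v τ) (v s) : ℝ)
      ≤ ∫ s in (0 : ℝ)..t, 2 * k s := by
    refine intervalIntegral.integral_mono_ae_restrict ht.1 h1 (hkt.const_mul 2) ?_
    filter_upwards [ae_restrict_of_ae_restrict_of_subset (Icc_subset_Icc_right ht.2) h] with s hs
    linarith
  have h4 : ∫ s in (0 : ℝ)..t, k s ≤ ∫ s in (0 : ℝ)..T, k s :=
    intervalIntegral.integral_mono_interval le_rfl ht.1 ht.2
      (Eventually.of_forall hk0) hk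
  simp only [intervalIntegral.integral_const_mul, intervalIntegral.integral_same, add_zero] at h2 h3
  linarith

/-- Testing the approximate inclusion at 0, where `f` vanishes, gives `⟨a, F⟩ ≤ δ(1 + R)` inside the
ball; outside it the truncated field is zero. Passing from `a` to the arc costs `δ m`. The squared
norm therefore grows by at most 1, the arc stays in the ball, and the truncation is never active
along it. -/
theorem FlowData.exists_approximant (D : FlowData T f A) (hT : 0 ≤ T) (u₀ : H) {R : ℝ}
    (hR : ‖u₀‖ ^ 2 + 1 ≤ R ^ 2) (hR0 : 0 ≤ R) :
    ∃ m : ℝ → ℝ, Integrable m volume ∧ MemLp m 2 (volume.restrict (Icc (0 : ℝ) T)) ∧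
      (∀ s, 0 ≤ m s) ∧ ∃ δ₀ > 0, ∀ δ, 0 < δ → δ ≤ δ₀ → ∃ a v, Approximant T f A u₀ R m δ a v := by
  obtain ⟨m, hm, hm2, hm0, hF⟩ := D.exists_field hR0
  refine ⟨m, hm, hm2, hm0, ?_⟩
  have hI : 0 ≤ ∫ s in (0 : ℝ)..T, m s := intervalIntegral.integral_nonneg hT fun s _ => hm0 s
  have hB : 0 < 1 + 2 * (T * (1 + R) + ∫ s in (0 : ℝ)..T, m s) := by positivity
  -- This `δ₀` makes the growth `2δ(T(1 + R) + ∫ m)` of the squared norm at most 1, and also gives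
  -- `δ ≤ 1`.
  refine ⟨(1 + 2 * (T * (1 + R) + ∫ s in (0 : ℝ)..T, m s))⁻¹, by positivity, fun δ hδ hδ0 => ?_⟩
  have hδB : δ * (1 + 2 * (T * (1 + R) + ∫ s in (0 : ℝ)..T, m s)) ≤ 1 := by
    calc _ ≤ (1 + 2 * (T * (1 + R) + ∫ s in (0 : ℝ)..T, m s))⁻¹ * _ := by gcongr
      _ = 1 := inv_mul_cancel₀ hB.ne'
  have hδ1 : δ ≤ 1 := hδ0.trans (inv_le_one_of_one_le₀ (by
    have : 0 ≤ T * (1 + R) := by positivity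
    linarith))
  obtain ⟨F, hFmeas, hFm, hF0, hFs⟩ := hF δ hδ hδ1
  obtain ⟨h, hh, hmh⟩ := exists_pos_forall_integral_le hm T hδ
  obtain ⟨a, ha, hv, har⟩ := exists_euler_scheme hFmeas hm hFm u₀ hh
  have hvm : ∀ᵐ s, ‖F s (a s)‖ ≤ m s := hFm.mono fun s hs => hs _
  have hvi : Integrable (fun s => F s (a s)) volume := hm.mono' hv hvm
  have hdist : ∀ s ∈ Icc (0 : ℝ) T,
      ‖a s - (u₀ + ∫ τ in (0 : ℝ)..s, F τ (a τ))‖ ≤ δ := by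
    intro s hs
    obtain ⟨r, hr0, hrs, hsr, hr⟩ := har s hs.1
    rw [hr, add_sub_add_left_eq_sub, norm_sub_rev,
      intervalIntegral.integral_interval_sub_left hvi.intervalIntegrable hvi.intervalIntegrable]
    refine le_trans ?_ (hmh r s hr0 hrs hs.2 hsr)
    exact intervalIntegral.norm_integral_le_of_norm_le hrs (hvm.mono fun s hs _ => hs)
      hm.intervalIntegrable
  have hu : ∀ t ∈ Icc (0 : ℝ) T, ‖u₀ + ∫ τ in (0 : ℝ)..t, F τ (a τ)‖ ≤ R := by
    intro t ht
    have hmi : IntervalIntegrable m volume 0 T := hm.intervalIntegrable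
    have := norm_sq_integral_le (k := fun s => δ * ((1 + R) + m s)) (u₀ := u₀) ht hvi
      ((intervalIntegrable_const.add hmi).const_mul δ)
      (fun s => mul_nonneg hδ.le (add_nonneg (by positivity) (hm0 s))) (by
        filter_upwards [hFs, ae_restrict_of_ae hvm, ae_restrict_mem measurableSet_Icc]
          with s hs hsm hsT
        have h1 : (inner ℝ (a s) (F s (a s)) : ℝ) ≤ δ * (1 + R) := by
          rcases le_or_gt ‖a s‖ R with hle | hlt
          · have h2 := hs (a s) hle 0
            rw [zero_sub, inner_neg_right, inner_sub_left, inner_neg_left, norm_neg,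
              D.zero s hsT, real_inner_comm] at h2
            have h3 := D.nonneg s hsT (a s)
            have h4 := D.pos s hsT (a s)
            have h5 : δ * (1 + ‖a s‖) ≤ δ * (1 + R) := by gcongr
            linarith
          · rw [hF0 s _ hlt, inner_zero_right]; positivity
        have h2 : (inner ℝ ((u₀ + ∫ τ in (0 : ℝ)..s, F τ (a τ)) - a s) (F s (a s)) : ℝ)
            ≤ δ * m s := by
          refine (real_inner_le_norm _ _).trans ?_
          rw [norm_sub_rev]
          exact mul_le_mul (hdist s hsT) hsm (norm_nonneg _) hδ.le
        rw [inner_sub_left] at h2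
        linarith)
    rw [intervalIntegral.integral_const_mul, intervalIntegral.integral_add
      intervalIntegrable_const hmi, intervalIntegral.integral_const, smul_eq_mul, sub_zero] at this
    refine le_of_sq_le_sq ?_ hR0
    nlinarith
  have haR : ∀ s ∈ Icc (0 : ℝ) T, ‖a s‖ ≤ R := by
    intro s hs
    -- The frozen point is the value of the arc at an earlier node, so it inherits the bound.
    obtain ⟨r, hr0, hrs, -, hr⟩ := har s hs.1
    rw [hr]
    exact hu r ⟨hr0, hrs.trans hs.2⟩
  refine ⟨a, fun s => F s (a s), ha, hv, hvm, hdist, haR, ?_⟩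
  filter_upwards [hFs, ae_restrict_mem measurableSet_Icc] with s hs hsT
  exact hs (a s) (haR s hsT)

omit [TopologicalSpace.SeparableSpace H] in
-- Test each inclusion at the other's frozen point and add: the values of `f` cancel, positivity of
-- `A` has the right sign, and `⟨a - a', v - v'⟩ ≤ (δ + δ')(1 + 2R)`. Replacing frozen points by
-- arcs costs `(δ + δ') * 2m`.
theorem Approximant.norm_sq_sub_le {u₀ : H} {R δ δ' : ℝ} {m : ℝ → ℝ} {a v a' v' : ℝ → H}
    (D : FlowData T f A) (hm : Integrable m volume) (hm0 : ∀ s, 0 ≤ m s) (hR : 0 ≤ R)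
    (hδ : 0 ≤ δ) (hδ' : 0 ≤ δ')
    (h : Approximant T f A u₀ R m δ a v) (h' : Approximant T f A u₀ R m δ' a' v') {t : ℝ}
    (ht : t ∈ Icc (0 : ℝ) T) :
    ‖(u₀ + ∫ τ in (0 : ℝ)..t, v τ) - (u₀ + ∫ τ in (0 : ℝ)..t, v' τ)‖ ^ 2
      ≤ (δ + δ') * (2 * ∫ s in (0 : ℝ)..T, ((1 + 2 * R) + 2 * m s)) := by
  have hv : Integrable v volume := hm.mono' h.meas_deriv h.bound
  have hv' : Integrable v' volume := hm.mono' h'.meas_deriv h'.bound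
  have hmi : IntervalIntegrable m volume 0 T := hm.intervalIntegrable
  have key := norm_sq_integral_le (v := fun s => v s - v' s)
    (k := fun s => (δ + δ') * ((1 + 2 * R) + 2 * m s)) (u₀ := 0) ht (hv.sub hv')
    ((intervalIntegrable_const.add (hmi.const_mul 2)).const_mul _)
    (fun s => mul_nonneg (by positivity) (add_nonneg (by positivity) (by linarith [hm0 s]))) (by
      filter_upwards [h.subgrad, h'.subgrad, ae_restrict_of_ae h.bound, ae_restrict_of_ae h'.bound,
        ae_restrict_mem measurableSet_Icc] with s h1 h2 h3 h4 hs
      have e1 := h1 (a' s)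
      have e2 := h2 (a s)
      have e3 := D.pos s hs (a s - a' s)
      have na : ‖a' s - a s‖ ≤ 2 * R := by
        linarith [norm_sub_le (a' s) (a s), h.frozen_le s hs, h'.frozen_le s hs]
      have e4 : δ * (1 + ‖a' s - a s‖) ≤ δ * (1 + 2 * R) := by gcongr
      have e5 : δ' * (1 + ‖a s - a' s‖) ≤ δ' * (1 + 2 * R) := by
        rw [norm_sub_rev]; gcongr
      have e6 : (inner ℝ (a s - a' s) (v s - v' s) : ℝ) ≤ (δ + δ') * (1 + 2 * R) := by
        rw [map_sub] at e3
        simp only [inner_sub_left, inner_sub_right, inner_neg_left] at e1 e2 e3 ⊢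
        rw [real_inner_comm (v s) (a s), real_inner_comm (v s) (a' s),
          real_inner_comm (v' s) (a s), real_inner_comm (v' s) (a' s)]
        linarith
      rw [intervalIntegral.integral_sub hv.intervalIntegrable hv'.intervalIntegrable, zero_add]
      have e7 : ‖(∫ τ in (0 : ℝ)..s, v τ) - (∫ τ in (0 : ℝ)..s, v' τ) - (a s - a' s)‖
          ≤ δ + δ' := by
        have : (∫ τ in (0 : ℝ)..s, v τ) - (∫ τ in (0 : ℝ)..s, v' τ) - (a s - a' s)
          = (a' s - (u₀ + ∫ τ in (0 : ℝ)..s, v' τ)) - (a s - (u₀ + ∫ τ in (0 : ℝ)..s, v τ)) := by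
          abel
        rw [this]
        refine (norm_sub_le _ _).trans ?_
        linarith [h.dist_le s hs, h'.dist_le s hs]
      have e8 := real_inner_le_norm ((∫ τ in (0 : ℝ)..s, v τ) - (∫ τ in (0 : ℝ)..s, v' τ)
        - (a s - a' s)) (v s - v' s)
      have e9 : ‖v s - v' s‖ ≤ 2 * m s := by linarith [norm_sub_le (v s) (v' s)]
      have e10 := mul_le_mul e7 e9 (norm_nonneg _) (by positivity : 0 ≤ δ + δ')
      rw [inner_sub_left] at e8
      linarith)
  rw [intervalIntegral.integral_sub hv.intervalIntegrable hv'.intervalIntegrable,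
    intervalIntegral.integral_const_mul] at key
  rw [add_sub_add_left_eq_sub]
  simp only [norm_zero, zero_add] at key
  linarith

end

end

/-! ### Passage to the limit and existence of a solution -/

section

variable {H : Type*} [NormedAddCommGroup H] [InnerProductSpace ℝ H]

/-- Carathéodory functions preserve measurability under composition. -/
theorem aestronglyMeasurable_comp_caratheodory {α X E : Type*} [MeasurableSpace α]
    {μ : Measure α} [TopologicalSpace X] [TopologicalSpace E]
    [TopologicalSpace.PseudoMetrizableSpace E] {g : α → X → E}
    (hg : ∀ x, AEStronglyMeasurable (fun t => g t x) μ) (hc : ∀ᵐ t ∂μ, Continuous (g t))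
    {a : α → X} (ha : AEStronglyMeasurable a μ) :
    AEStronglyMeasurable (fun t => g t (a t)) μ := by
  obtain ⟨b, hb, hab⟩ := ha
  -- Simple functions take finitely many values, where measurability in `t` suffices; continuity in
  -- the second variable carries it to the limit.
  have hlim : ∀ᵐ t ∂μ, Tendsto (fun n => g t (hb.approx n t)) atTop (𝓝 (g t (b t))) := by
    filter_upwards [hc] with t ht
    exact (ht.tendsto _).comp (hb.tendsto_approx t)
  refine (aestronglyMeasurable_of_tendsto_ae atTop (fun n => ?_) hlim).congr
    (hab.mono fun t ht => by simp only [ht])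
  let _ : MeasurableSpace (hb.approx n).range := ⊤
  have hk : Measurable fun t => (⟨hb.approx n t, (hb.approx n).mem_range_self t⟩ :
      (hb.approx n).range) := by
    refine measurable_to_countable' fun x => ?_
    have : (fun t => (⟨hb.approx n t, (hb.approx n).mem_range_self t⟩ :
      (hb.approx n).range)) ⁻¹' {x} = hb.approx n ⁻¹' {(x : X)} := by
      ext t; simp [Subtype.ext_iff]
    rw [this]
    exact (hb.approx n).measurableSet_fiber _
  exact aestronglyMeasurable_comp_countable (F := fun t (x : (hb.approx n).range) => g t x)
    (fun x => hg x) hk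

theorem integral_restrict_Ioc_eq {E : Type*} [NormedAddCommGroup E] [NormedSpace ℝ E]
    {g : ℝ → E} {T t : ℝ} (ht : t ∈ Icc (0 : ℝ) T) :
    ∫ s in Ioc 0 t, g s ∂(volume.restrict (Icc (0 : ℝ) T)) = ∫ s in (0 : ℝ)..t, g s := by
  rw [intervalIntegral.integral_of_le ht.1, Measure.restrict_restrict measurableSet_Ioc,
    inter_eq_left.2 (Ioc_subset_Icc_self.trans (Icc_subset_Icc_right ht.2))]

variable [CompleteSpace H] {T : ℝ} {f : ℝ → H → ℝ} {A : ℝ → H →L[ℝ] H}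

/-- If the primitives of a weakly convergent sequence converge weakly, the limit is the
primitive of the weak limit. -/
theorem eq_integral_of_weak_limit {l : Filter ℕ} [l.NeBot]
    {v : ℕ → ℝ → H} {V : ℕ → Lp H 2 (volume.restrict (Icc (0 : ℝ) T))}
    (hV : ∀ n, V n =ᵐ[volume.restrict (Icc (0 : ℝ) T)] v n)
    {ξ : Lp H 2 (volume.restrict (Icc (0 : ℝ) T))}
    (hξ : ∀ w, Tendsto (fun n => (inner ℝ (V n) w : ℝ)) l (𝓝 (inner ℝ ξ w))) {t : ℝ}
    (ht : t ∈ Icc (0 : ℝ) T) {z : H}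
    (hz : Tendsto (fun n => ∫ s in (0 : ℝ)..t, v n s) l (𝓝 z)) :
    z = ∫ s in (0 : ℝ)..t, ξ s := by
  refine ext_inner_left ℝ fun y => ?_
  have hfin : volume.restrict (Icc (0 : ℝ) T) (Ioc 0 t) ≠ ∞ := measure_ne_top _ _
  -- Pairing with `y` times the indicator of `(0,t]` yields the inner product of `y` with the
  -- primitive at `t`.
  have h1 := hξ (indicatorConstLp 2 measurableSet_Ioc hfin y)
  simp only [real_inner_comm (indicatorConstLp 2 measurableSet_Ioc hfin y),
    L2.inner_indicatorConstLp_eq_inner_setIntegral, integral_restrict_Ioc_eq ht] at h1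
  have h2 : ∀ n, ∫ s in (0 : ℝ)..t, V n s = ∫ s in (0 : ℝ)..t, v n s := fun n => by
    rw [← integral_restrict_Ioc_eq ht, ← integral_restrict_Ioc_eq ht]
    exact integral_congr_ae (ae_restrict_of_ae (hV n))
  simp only [h2] at h1
  exact tendsto_nhds_unique (tendsto_const_nhds.inner hz) h1

variable [TopologicalSpace.SeparableSpace H]

omit [CompleteSpace H] [TopologicalSpace.SeparableSpace H] in
theorem FlowData.aestronglyMeasurable_comp (D : FlowData T f A) {a : ℝ → H}
    (ha : AEStronglyMeasurable a (volume.restrict (Icc (0 : ℝ) T))) :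
    AEStronglyMeasurable (fun t => f t (a t)) (volume.restrict (Icc (0 : ℝ) T)) :=
  aestronglyMeasurable_comp_caratheodory (fun x => (D.meas x).aestronglyMeasurable)
    ((ae_restrict_mem measurableSet_Icc).mono fun t ht => D.cont t ht) ha

theorem FlowData.aestronglyMeasurable_op_comp (D : FlowData T f A) {a : ℝ → H}
    (ha : AEStronglyMeasurable a (volume.restrict (Icc (0 : ℝ) T))) :
    AEStronglyMeasurable (fun t => A t (a t)) (volume.restrict (Icc (0 : ℝ) T)) :=
  aestronglyMeasurable_comp_caratheodory (g := fun t x => A t x)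
    (fun x => D.aestronglyMeasurable_op x) (Eventually.of_forall fun t => (A t).continuous) ha

/-- The right-hand side of the limiting variational inequality tested with `y`. -/
def flowTest (f : ℝ → H → ℝ) (A : ℝ → H →L[ℝ] H) (m : ℝ → ℝ) (u : ℝ → H) (y : H) (δ : ℝ)
    (a : ℝ → H) (s : ℝ) : ℝ :=
  f s y - f s (a s) + inner ℝ (A s (a s)) (y - a s) + δ * (1 + ‖y - a s‖) + ‖a s - u s‖ * m s

theorem FlowData.aestronglyMeasurable_flowTest (D : FlowData T f A) {m : ℝ → ℝ}
    (hm : AEStronglyMeasurable m (volume.restrict (Icc (0 : ℝ) T))) {u a : ℝ → H}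
    (hu : AEStronglyMeasurable u (volume.restrict (Icc (0 : ℝ) T)))
    (ha : AEStronglyMeasurable a (volume.restrict (Icc (0 : ℝ) T))) (y : H) (δ : ℝ) :
    AEStronglyMeasurable (flowTest f A m u y δ a) (volume.restrict (Icc (0 : ℝ) T)) := by
  have hy : AEStronglyMeasurable (fun s => y - a s) (volume.restrict (Icc (0 : ℝ) T)) :=
    aestronglyMeasurable_const.sub ha
  exact ((((D.meas y).aestronglyMeasurable.sub (D.aestronglyMeasurable_comp ha)).add
    ((D.aestronglyMeasurable_op_comp ha).inner hy)).add
    ((aestronglyMeasurable_const.add hy.norm).const_mul δ)).add ((ha.sub hu).norm.mul hm)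

omit [CompleteSpace H] [TopologicalSpace.SeparableSpace H] in
-- The majorant is independent of `δ` and `a`, as dominated convergence requires.
theorem FlowData.exists_bound_flowTest (D : FlowData T f A) {m : ℝ → ℝ} (hm0 : ∀ s, 0 ≤ m s)
    (hm : Integrable m (volume.restrict (Icc (0 : ℝ) T))) {R : ℝ} (hR : 0 ≤ R) (y : H) (δ₀ : ℝ)
    {u : ℝ → H} (hu : ∀ s ∈ Icc (0 : ℝ) T, ‖u s‖ ≤ R) :
    ∃ b : ℝ → ℝ, Integrable b (volume.restrict (Icc (0 : ℝ) T)) ∧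
      ∀ δ, 0 ≤ δ → δ ≤ δ₀ → ∀ a : ℝ → H, (∀ s ∈ Icc (0 : ℝ) T, ‖a s‖ ≤ R) →
        ∀ᵐ s ∂(volume.restrict (Icc (0 : ℝ) T)), ‖flowTest f A m u y δ a s‖ ≤ b s := by
  obtain ⟨C, hC⟩ := D.bdd (R + ‖y‖)
  have hA : Integrable (fun s => ‖A s‖) (volume.restrict (Icc (0 : ℝ) T)) :=
    D.memLp_op.integrable (by norm_num)
  refine ⟨fun s => (C + ‖A s‖ * (R * (‖y‖ + R))) + (δ₀ * (1 + (‖y‖ + R)) + 2 * R * m s),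
    ((integrable_const C).add (hA.mul_const _)).add ((integrable_const _).add (hm.const_mul _)),
    fun δ hδ hδ0 a ha => ?_⟩
  filter_upwards [hC, ae_restrict_mem measurableSet_Icc] with s hs hsT
  have h1 := hs y (by linarith)
  have h2 := hs (a s) (by linarith [ha s hsT, norm_nonneg y])
  have h3 := D.nonneg s hsT y
  have h4 := D.nonneg s hsT (a s)
  have hya : ‖y - a s‖ ≤ ‖y‖ + R := (norm_sub_le _ _).trans (by linarith [ha s hsT])
  have h5 : |(inner ℝ (A s (a s)) (y - a s) : ℝ)| ≤ ‖A s‖ * (R * (‖y‖ + R)) := by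
    refine (abs_real_inner_le_norm _ _).trans ?_
    rw [← mul_assoc]
    exact mul_le_mul ((A s).le_opNorm_of_le (ha s hsT)) hya (norm_nonneg _) (by positivity)
  have h6 : δ * (1 + ‖y - a s‖) ≤ δ₀ * (1 + (‖y‖ + R)) :=
    mul_le_mul hδ0 (by linarith) (by positivity) (hδ.trans hδ0)
  have h7 : ‖a s - u s‖ * m s ≤ 2 * R * m s :=
    mul_le_mul_of_nonneg_right ((norm_sub_le _ _).trans (by linarith [ha s hsT, hu s hsT])) (hm0 s)
  have h8 : 0 ≤ δ * (1 + ‖y - a s‖) := by positivity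
  have h9 : 0 ≤ ‖a s - u s‖ * m s := mul_nonneg (norm_nonneg _) (hm0 s)
  rw [abs_le] at h5
  rw [Real.norm_eq_abs, abs_le, flowTest]
  constructor <;> linarith [h5.1, h5.2]

omit [CompleteSpace H] [TopologicalSpace.SeparableSpace H] in
theorem FlowData.tendsto_flowTest (D : FlowData T f A) {m : ℝ → ℝ} {u : ℝ → H} (y : H)
    {δ : ℕ → ℝ} (hδ : Tendsto δ atTop (𝓝 0)) {a : ℕ → ℝ → H} {s : ℝ} (hs : s ∈ Icc (0 : ℝ) T)
    (ha : Tendsto (fun n => a n s) atTop (𝓝 (u s))) :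
    Tendsto (fun n => flowTest f A m u y (δ n) (a n) s) atTop
      (𝓝 (flowTest f A m u y 0 u s)) := by
  have hy : Tendsto (fun n => y - a n s) atTop (𝓝 (y - u s)) := tendsto_const_nhds.sub ha
  exact (((tendsto_const_nhds.sub (((D.cont s hs).tendsto _).comp ha)).add
    ((((A s).continuous.tendsto _).comp ha).inner hy)).add
    (hδ.mul (tendsto_const_nhds.add hy.norm))).add
    ((ha.sub tendsto_const_nhds).norm.mul tendsto_const_nhds)

/-- Passage to the limit in the approximate inclusions. -/
theorem FlowData.subgradient_of_weak_limit (D : FlowData T f A) {m : ℝ → ℝ}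
    (hm0 : ∀ s, 0 ≤ m s) (hm : Integrable m volume) {R : ℝ} (hR : 0 ≤ R) {u₀ : H}
    {δ : ℕ → ℝ} {δ₀ : ℝ} (hδ0 : ∀ n, 0 ≤ δ n) (hδ1 : ∀ n, δ n ≤ δ₀)
    (hδ : Tendsto δ atTop (𝓝 0)) {a v : ℕ → ℝ → H}
    (h : ∀ n, Approximant T f A u₀ R m (δ n) (a n) (v n))
    {u : ℝ → H} (hu : AEStronglyMeasurable u (volume.restrict (Icc (0 : ℝ) T)))
    (hau : ∀ s ∈ Icc (0 : ℝ) T, Tendsto (fun n => a n s) atTop (𝓝 (u s)))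
    {l : Filter ℕ} [l.NeBot] (hl : l ≤ atTop)
    {V : ℕ → Lp H 2 (volume.restrict (Icc (0 : ℝ) T))}
    (hV : ∀ n, V n =ᵐ[volume.restrict (Icc (0 : ℝ) T)] v n)
    {ξ : Lp H 2 (volume.restrict (Icc (0 : ℝ) T))}
    (hξ : ∀ w, Tendsto (fun n => (inner ℝ (V n) w : ℝ)) l (𝓝 (inner ℝ ξ w))) :
    ∀ᵐ s ∂(volume.restrict (Icc (0 : ℝ) T)), ∀ y,
      f s (u s) + inner ℝ (-(ξ s) - A s (u s)) (y - u s) ≤ f s y := by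
  have hin : ∀ᵐ s ∂(volume.restrict (Icc (0 : ℝ) T)), s ∈ Icc (0 : ℝ) T :=
    ae_restrict_mem measurableSet_Icc
  have hmr : Integrable m (volume.restrict (Icc (0 : ℝ) T)) := hm.restrict
  have huR : ∀ s ∈ Icc (0 : ℝ) T, ‖u s‖ ≤ R := fun s hs =>
    le_of_tendsto (hau s hs).norm (Eventually.of_forall fun n => (h n).frozen_le s hs)
  -- For fixed `y` the inequality is integrated over an arbitrary measurable `E`: the left side
  -- converges weakly, the right side by domination, and varying `E` restores the pointwise
  -- statement.
  have key : ∀ y, ∀ᵐ s ∂(volume.restrict (Icc (0 : ℝ) T)),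
      -(inner ℝ (ξ s) (y - u s) : ℝ) ≤ flowTest f A m u y 0 u s := by
    intro y
    obtain ⟨b, hb, hbound⟩ := D.exists_bound_flowTest hm0 hmr hR y δ₀ huR
    have hδ00 : 0 ≤ δ₀ := (hδ0 0).trans (hδ1 0)
    have hyu : MemLp (fun s => y - u s) 2 (volume.restrict (Icc (0 : ℝ) T)) := by
      refine MemLp.of_bound (aestronglyMeasurable_const.sub hu) (‖y‖ + R) ?_
      filter_upwards [hin] with s hs
      exact (norm_sub_le _ _).trans (by linarith [huR s hs])
    have hinner : ∀ g : Lp H 2 (volume.restrict (Icc (0 : ℝ) T)),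
        Integrable (fun s => (inner ℝ (g s) (y - u s) : ℝ)) (volume.restrict (Icc (0 : ℝ) T)) := by
      intro g
      refine (L2.integrable_inner (𝕜 := ℝ) g (hyu.toLp _)).congr ?_
      filter_upwards [hyu.coeFn_toLp] with s hs
      rw [hs]
    refine ae_le_of_forall_setIntegral_le (hinner ξ).neg
      (hb.mono' (D.aestronglyMeasurable_flowTest hmr.1 hu hu y 0)
        (hbound 0 le_rfl hδ00 u huR)) fun E hE _ => ?_
    have hW := hyu.indicator hE
    have hpair : ∀ g : Lp H 2 (volume.restrict (Icc (0 : ℝ) T)), (inner ℝ g (hW.toLp _) : ℝ)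
        = ∫ s in E, inner ℝ (g s) (y - u s) ∂(volume.restrict (Icc (0 : ℝ) T)) := by
      intro g
      rw [L2.inner_def, ← integral_indicator hE]
      refine integral_congr_ae ?_
      filter_upwards [hW.coeFn_toLp] with s hs
      rw [hs]
      by_cases hsE : s ∈ E
      · rw [indicator_of_mem hsE, indicator_of_mem hsE]
      · rw [indicator_of_notMem hsE, indicator_of_notMem hsE, inner_zero_right]
    have hL : Tendsto (fun n => ∫ s in E, -(inner ℝ (V n s) (y - u s) : ℝ)
        ∂(volume.restrict (Icc (0 : ℝ) T))) l
        (𝓝 (∫ s in E, -(inner ℝ (ξ s) (y - u s) : ℝ) ∂(volume.restrict (Icc (0 : ℝ) T)))) := by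
      have := (hξ (hW.toLp _)).neg
      simp only [hpair] at this
      simpa only [integral_neg] using this
    have hR' : Tendsto (fun n => ∫ s in E, flowTest f A m u y (δ n) (a n) s
        ∂(volume.restrict (Icc (0 : ℝ) T))) l
        (𝓝 (∫ s in E, flowTest f A m u y 0 u s ∂(volume.restrict (Icc (0 : ℝ) T)))) := by
      refine Tendsto.mono_left ?_ hl
      refine tendsto_integral_of_dominated_convergence b
        (fun n => (D.aestronglyMeasurable_flowTest hmr.1 hu
          (h n).meas_frozen.restrict y (δ n)).restrict) hb.restrict
        (fun n => ae_restrict_of_ae (hbound _ (hδ0 n) (hδ1 n) _ (h n).frozen_le)) ?_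
      filter_upwards [ae_restrict_of_ae hin] with s hs
      exact D.tendsto_flowTest y hδ hs (hau s hs)
    refine le_of_tendsto_of_tendsto' hL hR' fun n => ?_
    refine integral_mono_ae (hinner (V n)).neg.restrict
      (hb.mono' (D.aestronglyMeasurable_flowTest hmr.1 hu (h n).meas_frozen.restrict y (δ n))
        (hbound _ (hδ0 n) (hδ1 n) _ (h n).frozen_le)).restrict (ae_restrict_of_ae ?_)
    filter_upwards [hV n, (h n).subgrad, ae_restrict_of_ae (h n).bound] with s h1 h2 h3
    have e1 := h2 y
    -- Cost of testing `v n` with `y - u` instead of `y - a n`; it accounts for the last term of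
    -- `flowTest`.
    have e2 : (inner ℝ (v n s) (u s - a n s) : ℝ) ≤ ‖a n s - u s‖ * m s := by
      refine (real_inner_le_norm _ _).trans ?_
      rw [norm_sub_rev, mul_comm]
      gcongr
    simp only [h1, flowTest]
    rw [inner_sub_left, inner_neg_left] at e1
    have e3 : (inner ℝ (v n s) (y - u s) : ℝ) + inner ℝ (v n s) (u s - a n s)
        = inner ℝ (v n s) (y - a n s) := by
      rw [← inner_add_right]; congr 1; abel
    linarith
  -- The null set in `key` depends on `y`, so only countably many `y` are used before extending by
  -- continuity.
  have hall : ∀ᵐ s ∂(volume.restrict (Icc (0 : ℝ) T)), ∀ k : ℕ,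
      -(inner ℝ (ξ s) (TopologicalSpace.denseSeq H k - u s) : ℝ) ≤
      flowTest f A m u (TopologicalSpace.denseSeq H k) 0 u s :=
    ae_all_iff.2 fun k => key _
  filter_upwards [hall, hin] with s hs hsT y
  have hcont := D.cont s hsT
  refine (TopologicalSpace.denseRange_denseSeq H).induction_on
    (p := fun y => f s (u s) + inner ℝ (-(ξ s) - A s (u s)) (y - u s) ≤ f s y) y
    (isClosed_le (by fun_prop) hcont) fun k => ?_
  have := hs k
  simp only [flowTest, sub_self, norm_zero, zero_mul, add_zero] at this
  rw [inner_sub_left, inner_neg_left]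
  linarith

/-- Existence of a strong solution of `-A_t u - u' ∈ ∂f(t,u)`, `u(0) = u₀`. -/
theorem FlowData.exists_solution (D : FlowData T f A) (hT : 0 ≤ T) (u₀ : H) :
    ∃ ξ : ℝ → H, MemLp ξ 2 (volume.restrict (Icc (0 : ℝ) T)) ∧
      ∀ᵐ s ∂(volume.restrict (Icc (0 : ℝ) T)), ∀ y,
        f s (u₀ + ∫ τ in (0 : ℝ)..s, ξ τ)
          + inner ℝ (-(ξ s) - A s (u₀ + ∫ τ in (0 : ℝ)..s, ξ τ))
            (y - (u₀ + ∫ τ in (0 : ℝ)..s, ξ τ)) ≤ f s y := by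
  have hR : (0 : ℝ) ≤ ‖u₀‖ + 1 := by positivity
  obtain ⟨m, hm, hm2, hm0, δ₀, hδ₀, happ⟩ := D.exists_approximant hT u₀ (R := ‖u₀‖ + 1)
    (by nlinarith [norm_nonneg u₀]) hR
  let δ : ℕ → ℝ := fun n => δ₀ * (1 / ((n : ℝ) + 1))
  have hδpos : ∀ n, 0 < δ n := fun n => by positivity
  have hδanti : Antitone δ := fun i j hij =>
    mul_le_mul_of_nonneg_left (one_div_le_one_div_of_le (by positivity) (by gcongr)) hδ₀.le
  have hδle : ∀ n, δ n ≤ δ₀ := fun n => by simpa [δ] using hδanti (Nat.zero_le n)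
  have hδlim : Tendsto δ atTop (𝓝 0) := by
    simpa only [mul_zero] using
      (tendsto_one_div_add_atTop_nhds_zero_nat (𝕜 := ℝ)).const_mul δ₀
  choose a v h using fun n => happ (δ n) (hδpos n) (hδle n)
  set K := 2 * ∫ s in (0 : ℝ)..T, ((1 + 2 * (‖u₀‖ + 1)) + 2 * m s) with hK
  have hcauchy : ∀ t ∈ Icc (0 : ℝ) T, CauchySeq fun n => u₀ + ∫ τ in (0 : ℝ)..t, v n τ := by
    intro t ht
    refine cauchySeq_of_le_tendsto_0 (fun N => Real.sqrt ((δ N + δ N) * K)) ?_ ?_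
    · intro i j N hi hj
      rw [dist_eq_norm]
      refine Real.le_sqrt_of_sq_le (((h i).norm_sq_sub_le D hm hm0 hR (hδpos i).le (hδpos j).le
        (h j) ht).trans ?_)
      have hK0 : 0 ≤ K := mul_nonneg zero_le_two (intervalIntegral.integral_nonneg hT
        fun s _ => add_nonneg (by positivity) (by linarith [hm0 s]))
      exact mul_le_mul_of_nonneg_right (add_le_add (hδanti hi) (hδanti hj)) hK0
    · have : Tendsto (fun N => Real.sqrt ((δ N + δ N) * K)) atTop (𝓝 (Real.sqrt ((0 + 0) * K))) :=
        ((hδlim.add hδlim).mul_const K).sqrt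
      simpa using this
  choose! z hz using fun t ht => cauchySeq_tendsto_of_complete (hcauchy t ht)
  have hvL : ∀ n, MemLp (v n) 2 (volume.restrict (Icc (0 : ℝ) T)) := fun n =>
    hm2.mono' (h n).meas_deriv.restrict (ae_restrict_of_ae (h n).bound)
  have hVm : ∀ n, ‖(hvL n).toLp (v n)‖ ≤ ‖hm2.toLp m‖ := by
    intro n
    refine Lp.norm_le_norm_of_ae_le ?_
    filter_upwards [(hvL n).coeFn_toLp, hm2.coeFn_toLp, ae_restrict_of_ae (h n).bound]
      with s h1 h2 h3
    rw [h1, h2]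
    exact h3.trans (le_abs_self _)
  -- Arcs converge strongly along `atTop`, derivatives weakly along a finer ultrafilter; the two
  -- limits are compared along the latter.
  obtain ⟨ξ, hξ⟩ := exists_weak_limit (hyperfilter ℕ) hVm
  have hl : ((hyperfilter ℕ : Ultrafilter ℕ) : Filter ℕ) ≤ atTop := Nat.hyperfilter_le_atTop
  have hzeq : ∀ t ∈ Icc (0 : ℝ) T, z t = u₀ + ∫ τ in (0 : ℝ)..t, ξ τ := by
    intro t ht
    have h1 : Tendsto (fun n => ∫ τ in (0 : ℝ)..t, v n τ) (hyperfilter ℕ : Ultrafilter ℕ)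
        (𝓝 (z t - u₀)) := by
      have := ((hz t ht).sub_const u₀).mono_left hl
      simpa only [add_sub_cancel_left] using this
    rw [← eq_integral_of_weak_limit (fun n => (hvL n).coeFn_toLp) hξ ht h1, add_sub_cancel]
  have hau : ∀ s ∈ Icc (0 : ℝ) T,
      Tendsto (fun n => a n s) atTop (𝓝 (u₀ + ∫ τ in (0 : ℝ)..s, ξ τ)) := by
    intro s hs
    have h1 : Tendsto (fun n => a n s - (u₀ + ∫ τ in (0 : ℝ)..s, v n τ)) atTop (𝓝 0) :=
      squeeze_zero_norm (fun n => (h n).dist_le s hs) hδlim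
    rw [← hzeq s hs]
    simpa using h1.add (hz s hs)
  refine ⟨ξ, Lp.memLp ξ, D.subgradient_of_weak_limit hm0 hm hR (fun n => (hδpos n).le) hδle hδlim h
    ?_ hau hl (fun n => (hvL n).coeFn_toLp) hξ⟩
  refine aestronglyMeasurable_of_tendsto_ae atTop (fun n => (h n).meas_frozen.restrict)
    ((ae_restrict_mem measurableSet_Icc).mono hau)

end

/-! ### Fenchel duality, extended integrals, regularity from the growth bounds -/

section

variable {H : Type*} [NormedAddCommGroup H] [InnerProductSpace ℝ H]

/-- The Fenchel inequality; finiteness of `ψ` rules out `⊤ + ⊥`. -/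
theorem coe_inner_le_add_conj {ψ : H → EReal} {g : H → ℝ} (hψ : ∀ x, ψ x = (g x : EReal))
    (x ξ : H) : ((inner ℝ x ξ : ℝ) : EReal) ≤ ψ x + conj ψ ξ := by
  have h : (((inner ℝ x ξ : ℝ) - g x : ℝ) : EReal) ≤ conj ψ ξ := by
    rw [EReal.coe_sub, ← hψ]
    exact le_iSup (fun x => ((inner ℝ x ξ : ℝ) : EReal) - ψ x) x
  calc ((inner ℝ x ξ : ℝ) : EReal) = (g x : EReal) + (((inner ℝ x ξ : ℝ) - g x : ℝ) : EReal) := by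
        rw [← EReal.coe_add]; congr 1; ring
    _ ≤ ψ x + conj ψ ξ := by rw [hψ]; gcongr

theorem add_conj_eq_coe_inner_iff {ψ : H → EReal} {g : H → ℝ} (hψ : ∀ x, ψ x = (g x : EReal))
    (x ξ : H) : ψ x + conj ψ ξ = ((inner ℝ x ξ : ℝ) : EReal) ↔
      ∀ y, g x + inner ℝ ξ (y - x) ≤ g y := by
  constructor
  · intro h y
    have h1 : (((inner ℝ y ξ : ℝ) - g y : ℝ) : EReal) ≤ conj ψ ξ := by
      rw [EReal.coe_sub, ← hψ]
      exact le_iSup (fun x => ((inner ℝ x ξ : ℝ) : EReal) - ψ x) y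
    have h2 : ((g x + ((inner ℝ y ξ : ℝ) - g y) : ℝ) : EReal) ≤ ((inner ℝ x ξ : ℝ) : EReal) := by
      rw [← h, hψ, EReal.coe_add]; gcongr
    have h3 := EReal.coe_le_coe_iff.1 h2
    rw [inner_sub_right, real_inner_comm y ξ, real_inner_comm x ξ]
    linarith
  · intro h
    refine le_antisymm ?_ (coe_inner_le_add_conj hψ x ξ)
    have h1 : conj ψ ξ ≤ (((inner ℝ x ξ : ℝ) - g x : ℝ) : EReal) := by
      refine iSup_le fun y => ?_
      rw [hψ, ← EReal.coe_sub, EReal.coe_le_coe_iff]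
      have := h y
      rw [inner_sub_right, real_inner_comm y ξ, real_inner_comm x ξ] at this
      linarith
    calc ψ x + conj ψ ξ ≤ (g x : EReal) + (((inner ℝ x ξ : ℝ) - g x : ℝ) : EReal) := by
          rw [hψ]; gcongr
      _ = _ := by rw [← EReal.coe_add]; congr 1; ring

theorem conj_nonneg {ψ : H → EReal} (h0 : ψ 0 = 0) (ξ : H) : 0 ≤ conj ψ ξ := by
  refine le_trans ?_ (le_iSup (fun x => ((inner ℝ x ξ : ℝ) : EReal) - ψ x) 0)
  simp [h0]

/-- A countable supremum is what makes the conjugate measurable in time. -/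
theorem conj_eq_iSup_denseSeq [TopologicalSpace.SeparableSpace H] {ψ : H → EReal} {g : H → ℝ}
    (hψ : ∀ x, ψ x = (g x : EReal)) (hg : Continuous g) (ξ : H) :
    conj ψ ξ = ⨆ k, (((inner ℝ (TopologicalSpace.denseSeq H k) ξ : ℝ)
      - g (TopologicalSpace.denseSeq H k) : ℝ) : EReal) := by
  refine le_antisymm (iSup_le fun y => ?_) (iSup_le fun k => ?_)
  · rw [hψ, ← EReal.coe_sub]
    refine (TopologicalSpace.denseRange_denseSeq H).induction_on
      (p := fun y => (((inner ℝ y ξ : ℝ) - g y : ℝ) : EReal) ≤ _) y ?_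
      fun k => le_iSup (fun k => (((inner ℝ (TopologicalSpace.denseSeq H k) ξ : ℝ)
        - g (TopologicalSpace.denseSeq H k) : ℝ) : EReal)) k
    exact isClosed_le (continuous_coe_real_ereal.comp (by fun_prop)) continuous_const
  · rw [EReal.coe_sub, ← hψ]
    exact le_iSup (fun x => ((inner ℝ x ξ : ℝ) : EReal) - ψ x) _

theorem eintegral_eq_lintegral {T : ℝ} {L : ℝ → EReal}
    (hL : ∀ᵐ t ∂(volume.restrict (Icc (0 : ℝ) T)), 0 ≤ L t) :
    eintegral T L = ((∫⁻ t in Icc (0 : ℝ) T, (L t).toENNReal : ℝ≥0∞) : EReal) := by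
  have : ∫⁻ t in Icc (0 : ℝ) T, (-L t).toENNReal = 0 := by
    rw [lintegral_congr_ae (g := fun _ => 0), lintegral_zero]
    filter_upwards [hL] with t ht
    exact EReal.toENNReal_of_nonpos (by simpa using ht)
  rw [eintegral, this]
  simp

theorem ofReal_integral_le_lintegral_ofReal {α : Type*} [MeasurableSpace α] {μ : Measure α}
    {h : α → ℝ} (hh : Integrable h μ) :
    ENNReal.ofReal (∫ t, h t ∂μ) ≤ ∫⁻ t, ENNReal.ofReal (h t) ∂μ := by
  calc ENNReal.ofReal (∫ t, h t ∂μ) ≤ ENNReal.ofReal (∫ t, max (h t) 0 ∂μ) :=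
        ENNReal.ofReal_le_ofReal (integral_mono hh hh.pos_part fun t => le_max_left _ _)
    _ = ∫⁻ t, ENNReal.ofReal (max (h t) 0) ∂μ :=
        ofReal_integral_eq_lintegral_ofReal hh.pos_part
          (Eventually.of_forall fun t => le_max_right _ _)
    _ = ∫⁻ t, ENNReal.ofReal (h t) ∂μ := by simp

theorem ofReal_le_toENNReal {r : ℝ} {x : EReal} (h : (r : EReal) ≤ x) :
    ENNReal.ofReal r ≤ x.toENNReal := by
  rw [← EReal.real_coe_toENNReal]
  exact EReal.toENNReal_le_toENNReal h

theorem coe_integral_le_eintegral {T : ℝ} {L : ℝ → EReal} {h : ℝ → ℝ}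
    (hL : ∀ᵐ t ∂(volume.restrict (Icc (0 : ℝ) T)), 0 ≤ L t)
    (hh : Integrable h (volume.restrict (Icc (0 : ℝ) T)))
    (hle : ∀ᵐ t ∂(volume.restrict (Icc (0 : ℝ) T)), (h t : EReal) ≤ L t) :
    ((∫ t in Icc (0 : ℝ) T, h t : ℝ) : EReal) ≤ eintegral T L := by
  rw [eintegral_eq_lintegral hL]
  calc ((∫ t in Icc (0 : ℝ) T, h t : ℝ) : EReal)
      ≤ ((ENNReal.ofReal (∫ t in Icc (0 : ℝ) T, h t) : ℝ≥0∞) : EReal) := by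
        rw [EReal.coe_ennreal_ofReal]
        exact EReal.coe_le_coe_iff.2 (le_max_left _ _)
    _ ≤ _ := EReal.coe_ennreal_le_coe_ennreal_iff.2 ((ofReal_integral_le_lintegral_ofReal hh).trans
        (lintegral_mono_ae (hle.mono fun t ht => ofReal_le_toENNReal ht)))

theorem eintegral_eq_coe_integral {T : ℝ} {L : ℝ → EReal} {h : ℝ → ℝ}
    (hL : ∀ᵐ t ∂(volume.restrict (Icc (0 : ℝ) T)), 0 ≤ L t)
    (hh : Integrable h (volume.restrict (Icc (0 : ℝ) T)))
    (heq : ∀ᵐ t ∂(volume.restrict (Icc (0 : ℝ) T)), L t = (h t : EReal)) :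
    eintegral T L = ((∫ t in Icc (0 : ℝ) T, h t : ℝ) : EReal) := by
  have h0 : 0 ≤ᵐ[volume.restrict (Icc (0 : ℝ) T)] h := by
    filter_upwards [hL, heq] with t h1 h2
    rw [h2] at h1
    exact_mod_cast h1
  rw [eintegral_eq_lintegral hL, lintegral_congr_ae (g := fun t => ENNReal.ofReal (h t)),
    ← ofReal_integral_eq_lintegral_ofReal hh h0, EReal.coe_ennreal_ofReal,
    max_eq_left (integral_nonneg_of_ae h0)]
  filter_upwards [heq] with t ht
  rw [ht, EReal.real_coe_toENNReal]

/-- Since `h` may change sign, two steps are needed: equality of lower integrals first identifies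
`L` with the positive part of `h`, and then `∫ h⁺ ≤ ∫ h` forces `h = h⁺` a.e. -/
theorem ae_eq_of_eintegral_le {T : ℝ} {L : ℝ → EReal} {h : ℝ → ℝ}
    (hL : ∀ᵐ t ∂(volume.restrict (Icc (0 : ℝ) T)), 0 ≤ L t)
    (hLm : AEMeasurable L (volume.restrict (Icc (0 : ℝ) T)))
    (hh : Integrable h (volume.restrict (Icc (0 : ℝ) T)))
    (hle : ∀ᵐ t ∂(volume.restrict (Icc (0 : ℝ) T)), (h t : EReal) ≤ L t)
    (hint : eintegral T L ≤ ((∫ t in Icc (0 : ℝ) T, h t : ℝ) : EReal)) :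
    ∀ᵐ t ∂(volume.restrict (Icc (0 : ℝ) T)), L t = (h t : EReal) := by
  rw [eintegral_eq_lintegral hL] at hint
  have hk : ∀ᵐ t ∂(volume.restrict (Icc (0 : ℝ) T)),
      ENNReal.ofReal (h t) ≤ (L t).toENNReal := hle.mono fun t ht => ofReal_le_toENNReal ht
  have h1 : ∫⁻ t in Icc (0 : ℝ) T, (L t).toENNReal
      ≤ ENNReal.ofReal (∫ t in Icc (0 : ℝ) T, h t) := by
    rw [← EReal.coe_ennreal_le_coe_ennreal_iff, EReal.coe_ennreal_ofReal]
    exact hint.trans (EReal.coe_le_coe_iff.2 (le_max_left _ _))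
  have h2 := ofReal_integral_le_lintegral_ofReal hh
  have h3 : ∫⁻ t in Icc (0 : ℝ) T, ENNReal.ofReal (h t) ≠ ∞ :=
    ((lintegral_mono_ae hk).trans_lt (h1.trans_lt ENNReal.ofReal_lt_top)).ne
  have h4 : (fun t => ENNReal.ofReal (h t)) =ᵐ[volume.restrict (Icc (0 : ℝ) T)]
      fun t => (L t).toENNReal :=
    ae_eq_of_ae_le_of_lintegral_le hk h3 hLm.ereal_toENNReal (h1.trans h2)
  have h5 : ∫ t in Icc (0 : ℝ) T, max (h t) 0 ≤ ∫ t in Icc (0 : ℝ) T, h t := by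
    have e1 := ofReal_integral_eq_lintegral_ofReal hh.pos_part
      (Eventually.of_forall fun t => le_max_right (h t) 0)
    simp only [ENNReal.ofReal_max, ENNReal.ofReal_zero, zero_le, sup_of_le_left] at e1
    rw [lintegral_congr_ae h4] at e1
    rw [← e1, EReal.coe_ennreal_ofReal, EReal.coe_le_coe_iff] at hint
    exact (le_max_left _ _).trans hint
  have h6 : h =ᵐ[volume.restrict (Icc (0 : ℝ) T)] fun t => max (h t) 0 :=
    (integral_eq_iff_of_ae_le hh hh.pos_part (Eventually.of_forall fun t => le_max_left _ _)).1
      (le_antisymm (integral_mono hh hh.pos_part fun t => le_max_left _ _) h5)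
  filter_upwards [hL, h4, h6] with t e1 e2 e3
  rw [← EReal.coe_toENNReal e1, ← e2, EReal.coe_ennreal_ofReal, ← e3]

theorem le_of_forall_le_add_mul {a b c : ℝ} (h : ∀ s, 0 < s → s ≤ 1 → a ≤ b + s * c) : a ≤ b := by
  refine ge_of_tendsto (f := fun s : ℝ => b + s * c) (x := 𝓝[>] 0) ?_ ?_
  · have : Tendsto (fun s : ℝ => b + s * c) (𝓝 0) (𝓝 (b + 0 * c)) :=
      (Continuous.tendsto (by fun_prop) 0)
    rw [zero_mul, add_zero] at this
    exact this.mono_left nhdsWithin_le_nhds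
  · filter_upwards [Ioc_mem_nhdsGT zero_lt_one] with s hs using h s hs.1 hs.2

section antisymm

variable [CompleteSpace H]

theorem inner_antisymmPart_left (B : H →L[ℝ] H) (x y : H) :
    (inner ℝ (antisymmPart B x) y : ℝ) = 1 / 2 * (inner ℝ (B x) y - inner ℝ (B y) x) := by
  simp only [antisymmPart, smul_apply, sub_apply,
    real_inner_smul_left, inner_sub_left, ContinuousLinearMap.adjoint_inner_left]
  rw [real_inner_comm (B y) x]

/-- The subdifferential of a convex function plus a nonnegative quadratic form. -/
theorem subgradient_add_quadratic_iff {f : H → ℝ} (hf : ConvexOn ℝ univ f) {B : H →L[ℝ] H}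
    (hB : ∀ x, 0 ≤ (inner ℝ (B x) x : ℝ)) (x w : H) :
    (∀ y, (f x + 1 / 2 * inner ℝ (B x) x) + inner ℝ (-(antisymmPart B x) - w) (y - x)
        ≤ f y + 1 / 2 * inner ℝ (B y) y) ↔
      ∀ y, f x + inner ℝ (-(B x) - w) (y - x) ≤ f y := by
  have hexp : ∀ d : H, (inner ℝ (B (x + d)) (x + d) : ℝ)
      = inner ℝ (B x) x + inner ℝ (B x) d + inner ℝ (B d) x + inner ℝ (B d) d := by
    intro d
    rw [map_add, inner_add_left, inner_add_right, inner_add_right]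
    ring
  constructor
  · intro h y
    -- Test at `x + s • (y - x)` and divide by `s`: the quadratic remainder is of order `s²` and
    -- vanishes as `s → 0`, while convexity bounds the increment of `f`.
    refine le_of_forall_le_add_mul (c := 1 / 2 * inner ℝ (B (y - x)) (y - x)) fun s hs hs1 => ?_
    have h1 := h (x + s • (y - x))
    have h2 : f (x + s • (y - x)) ≤ (1 - s) * f x + s * f y := by
      have := hf.2 (mem_univ x) (mem_univ y) (sub_nonneg.2 hs1) hs.le (by ring)
      rwa [show (1 - s) • x + s • y = x + s • (y - x) by module] at this
    rw [add_sub_cancel_left, hexp] at h1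
    simp only [inner_sub_left (-(antisymmPart B x)) w, inner_neg_left, inner_antisymmPart_left,
      map_smul, real_inner_smul_left, real_inner_smul_right] at h1
    rw [inner_sub_left, inner_neg_left]
    have h3 : s * (f x + (-inner ℝ (B x) (y - x) - inner ℝ w (y - x)))
        ≤ s * (f y + s * (1 / 2 * inner ℝ (B (y - x)) (y - x))) := by
      linarith
    exact le_of_mul_le_mul_left h3 hs
  -- Conversely the remainder `½⟨B(y - x), y - x⟩` is nonnegative and may be dropped.
  · intro h y
    have h1 := h y
    have h2 := hexp (y - x)
    rw [add_sub_cancel] at h2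
    simp only [inner_sub_left _ w, inner_neg_left] at h1 ⊢
    rw [h2, inner_antisymmPart_left]
    linarith [hB (y - x)]

end antisymm

/-- The regularity of a convex function with `0 ≤ β‖x‖ᵖ ≤ φ x + ½⟨Bx,x⟩ ≤ γ‖x‖^q`. -/
theorem regular_of_bounds {φ : H → EReal} (hφ : ConvexFun φ) {B : H →L[ℝ] H}
    (hB : ∀ x, 0 ≤ (inner ℝ (B x) x : ℝ)) {p q β γ : ℝ} (hp : 0 < p) (hq : 0 < q)
    (hβ : 0 < β) (hγ : 0 < γ)
    (hb : ∀ x : H, ((β * ‖x‖ ^ p : ℝ) : EReal)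
          ≤ φ x + (((1 / 2 : ℝ) * inner ℝ (B x) x : ℝ) : EReal) ∧
        φ x + (((1 / 2 : ℝ) * inner ℝ (B x) x : ℝ) : EReal) ≤ ((γ * ‖x‖ ^ q : ℝ) : EReal)) :
    (∀ x, φ x = ((φ x).toReal : EReal)) ∧ ConvexOn ℝ univ (fun x => (φ x).toReal) ∧
      Continuous (fun x => (φ x).toReal) ∧ (φ 0).toReal = 0 ∧ (∀ x, 0 ≤ (φ x).toReal) ∧
      ∀ x, (φ x).toReal ≤ γ * ‖x‖ ^ q := by
  have hfin : ∀ x, φ x = ((φ x).toReal : EReal) := by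
    intro x
    refine (EReal.coe_toReal ?_ ?_).symm
    · intro h
      have := (hb x).2
      rw [h, EReal.top_add_coe] at this
      exact absurd this (not_le.2 (EReal.coe_lt_top _))
    · intro h
      have := (hb x).1
      rw [h, EReal.bot_add] at this
      exact absurd this (not_le.2 (EReal.bot_lt_coe _))
  set f : H → ℝ := fun x => (φ x).toReal with hfdef
  have hfx : ∀ x, φ x = (f x : EReal) := hfin
  have hb' : ∀ x, β * ‖x‖ ^ p ≤ f x + 1 / 2 * inner ℝ (B x) x ∧
      f x + 1 / 2 * inner ℝ (B x) x ≤ γ * ‖x‖ ^ q := by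
    intro x
    have := hb x
    rw [hfx, ← EReal.coe_add, EReal.coe_le_coe_iff, EReal.coe_le_coe_iff] at this
    exact this
  have hconv : ConvexOn ℝ univ f := by
    refine ⟨convex_univ, fun x _ y _ a b ha hb hab => ?_⟩
    have := hφ (x := (x, f x)) (by simp [hfx]) (y := (y, f y)) (by simp [hfx]) ha hb hab
    simpa [hfx] using this
  have h0 : f 0 = 0 := by
    have := hb' 0
    rw [norm_zero, Real.zero_rpow hp.ne', Real.zero_rpow hq.ne', inner_zero_right] at this
    linarith [this.1, this.2]
  have hnn : ∀ x, 0 ≤ f x := by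
    intro x
    -- The lower bound controls only the sum with the quadratic form. Along `s • x` that form is
    -- `O(s²)`, whereas `f (s • x) ≤ s * f x`, so it disappears after division by `s`.
    refine le_of_forall_le_add_mul (c := 1 / 2 * inner ℝ (B x) x) fun s hs hs1 => ?_
    have h1 := (hb' (s • x)).1
    have h2 : f (s • x) ≤ s * f x := by
      have := hconv.2 (mem_univ 0) (mem_univ x) (sub_nonneg.2 hs1) hs.le (by ring)
      simpa [h0] using this
    have h3 : 0 ≤ β * ‖s • x‖ ^ p := by positivity
    rw [map_smul, real_inner_smul_left, real_inner_smul_right] at h1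
    have h4 : 0 ≤ s * (f x + s * (1 / 2 * inner ℝ (B x) x)) := by linarith
    exact nonneg_of_mul_nonneg_right h4 hs
  have hub : ∀ x, f x ≤ γ * ‖x‖ ^ q := fun x => by linarith [(hb' x).2, hB x]
  refine ⟨hfin, hconv, ?_, h0, hnn, hub⟩
  rw [← continuousOn_univ]
  -- A convex function bounded above near one point is continuous; the upper growth bound supplies
  -- this on the unit ball.
  have hbdd : ∃ x₀ ∈ (univ : Set H), (𝓝 x₀).IsBoundedUnder (· ≤ ·) f := by
    refine ⟨0, mem_univ 0, γ, ?_⟩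
    rw [eventually_map]
    filter_upwards [Metric.ball_mem_nhds (0 : H) zero_lt_one] with x hx
    rw [mem_ball_zero_iff] at hx
    calc f x ≤ γ * ‖x‖ ^ q := hub x
      _ ≤ γ * 1 := by gcongr; exact Real.rpow_le_one (norm_nonneg _) hx.le hq.le
      _ = γ := mul_one γ
  exact ((hconv.continuousOn_tfae isOpen_univ univ_nonempty).out 1 3).2 hbdd

omit [InnerProductSpace ℝ H] in
-- A section of a jointly measurable function is measurable, and its preimages are traces on `[0,T]`
-- of null-measurable sets.
theorem LebesgueBorelMeasurable.aemeasurable {T : ℝ} {φ : ℝ → H → EReal}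
    (hφ : LebesgueBorelMeasurable T φ) (x : H) :
    AEMeasurable (fun t => φ t x) (volume.restrict (Icc (0 : ℝ) T)) := by
  let _ : MeasurableSpace H := borel H
  refine NullMeasurable.aemeasurable fun s hs => ?_
  let mI : MeasurableSpace (Icc (0 : ℝ) T) := MeasurableSpace.comap Subtype.val
        (inferInstance : MeasurableSpace (NullMeasurableSpace ℝ volume))
  have h1 : @Measurable (Icc (0 : ℝ) T) EReal mI _ (fun t => φ t x) :=
    Measurable.comp (g := fun z : Icc (0 : ℝ) T × H => φ z.1 z.2) hφ measurable_prodMk_right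
  obtain ⟨N, hN, hNs⟩ := h1 hs
  have hN' : NullMeasurableSet N volume := hN
  have : ((fun t => φ t x) ⁻¹' s) ∩ Icc (0 : ℝ) T = N ∩ Icc (0 : ℝ) T := by
    ext t
    constructor
    · rintro ⟨ht, hT⟩
      have : (⟨t, hT⟩ : Icc (0 : ℝ) T) ∈ Subtype.val ⁻¹' N := by rw [hNs]; exact ht
      exact ⟨this, hT⟩
    · rintro ⟨ht, hT⟩
      have : (⟨t, hT⟩ : Icc (0 : ℝ) T) ∈ (fun t : Icc (0 : ℝ) T => φ t x) ⁻¹' s := by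
        rw [← hNs]; exact ht
      exact ⟨this, hT⟩
  rw [nullMeasurableSet_restrict measurableSet_Icc.nullMeasurableSet, this]
  exact hN'.inter measurableSet_Icc.nullMeasurableSet

end

/-! ### The variational principle: zeros of the action are the solutions -/

section

variable {H : Type*} [NormedAddCommGroup H] [InnerProductSpace ℝ H]

theorem psi_eq_coe {φ : ℝ → H → EReal} {f : ℝ → H → ℝ} (A : ℝ → H →L[ℝ] H) {t : ℝ}
    (h : ∀ x, φ t x = (f t x : EReal)) (x : H) :
    psi φ A t x = ((f t x + 1 / 2 * inner ℝ (A t x) x : ℝ) : EReal) := by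
  rw [psi, h, ← EReal.coe_add]

theorem mem_subdiff_iff {φ : H → EReal} {f : H → ℝ} (h : ∀ x, φ x = (f x : EReal)) (x ξ : H) :
    ξ ∈ subdiff φ x ↔ ∀ y, f x + inner ℝ ξ (y - x) ≤ f y := by
  simp only [subdiff, mem_ofPred_eq, h, ← EReal.coe_add, EReal.coe_le_coe_iff]
  simp

theorem A2.hasDerivAt_deriv {T : ℝ} {u : ℝ → H} (hu : u ∈ A2 H T) :
    ∀ᵐ t ∂(volume.restrict (Icc (0 : ℝ) T)), HasDerivAt u (deriv u t) t :=
  hu.2.1.mono fun _ ht => ht.hasDerivAt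

theorem A2.aestronglyMeasurable {T : ℝ} (hT : 0 ≤ T) {u : ℝ → H} (hu : u ∈ A2 H T) :
    AEStronglyMeasurable u (volume.restrict (Icc (0 : ℝ) T)) := by
  have := hu.1.continuousOn
  rw [uIcc_of_le hT] at this
  exact this.aestronglyMeasurable_of_isCompact isCompact_Icc measurableSet_Icc

theorem A2.integral_inner_deriv {T : ℝ} (hT : 0 ≤ T) {u : ℝ → H} (hu : u ∈ A2 H T) :
    Integrable (fun t => -(inner ℝ (u t) (deriv u t) : ℝ)) (volume.restrict (Icc (0 : ℝ) T)) ∧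
      ∫ t in Icc (0 : ℝ) T, -(inner ℝ (u t) (deriv u t) : ℝ)
        = 1 / 2 * (‖u 0‖ ^ 2 - ‖u T‖ ^ 2) := by
  obtain ⟨h1, h2⟩ := norm_sq_sub_norm_sq_eq_integral hu.1 (A2.hasDerivAt_deriv hu) ⟨hT, le_rfl⟩
  rw [intervalIntegrable_iff_integrableOn_Icc_of_le hT] at h1
  rw [intervalIntegral.integral_of_le hT, ← integral_Icc_eq_integral_Ioc,
    integral_const_mul] at h2
  refine ⟨(h1.const_mul (-1 / 2)).congr (Eventually.of_forall fun t => ?_), ?_⟩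
  · simp only; ring
  · rw [integral_neg]; linarith

section

variable [CompleteSpace H]

/-- An antisymmetric operator vanishes on the diagonal. -/
theorem inner_neg_antisymmPart_sub (B : H →L[ℝ] H) (x w : H) :
    (inner ℝ x (-(antisymmPart B x) - w) : ℝ) = -(inner ℝ x w) := by
  rw [inner_sub_right, inner_neg_right, real_inner_comm, inner_antisymmPart_left]
  ring

variable {T : ℝ} {φ : ℝ → H → EReal} {f : ℝ → H → ℝ} {A : ℝ → H →L[ℝ] H}

omit [CompleteSpace H] in
theorem FlowData.psi_zero (D : FlowData T f A)
    (hφ : ∀ t ∈ Icc (0 : ℝ) T, ∀ x, φ t x = (f t x : EReal)) {t : ℝ} (ht : t ∈ Icc (0 : ℝ) T) :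
    psi φ A t 0 = 0 := by
  rw [psi_eq_coe A (hφ t ht), D.zero t ht, inner_zero_right]
  simp

omit [CompleteSpace H] in
theorem FlowData.lagrangian_nonneg (D : FlowData T f A)
    (hφ : ∀ t ∈ Icc (0 : ℝ) T, ∀ x, φ t x = (f t x : EReal)) {t : ℝ} (ht : t ∈ Icc (0 : ℝ) T)
    (x ξ : H) : 0 ≤ psi φ A t x + conj (psi φ A t) ξ := by
  refine add_nonneg ?_ (conj_nonneg (D.psi_zero hφ ht) ξ)
  rw [psi_eq_coe A (hφ t ht)]
  have := D.nonneg t ht x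
  have := D.pos t ht x
  exact EReal.coe_nonneg.2 (by positivity)

theorem FlowData.neg_inner_le_lagrangian
    (hφ : ∀ t ∈ Icc (0 : ℝ) T, ∀ x, φ t x = (f t x : EReal)) {t : ℝ} (ht : t ∈ Icc (0 : ℝ) T)
    (x w : H) : ((-(inner ℝ x w) : ℝ) : EReal) ≤
      psi φ A t x + conj (psi φ A t) (-(antisymmPart (A t) x) - w) := by
  rw [← inner_neg_antisymmPart_sub (A t)]
  exact coe_inner_le_add_conj (psi_eq_coe A (hφ t ht)) _ _

/-- Equality in the Fenchel inequality characterizes the differential inclusion. -/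
theorem FlowData.lagrangian_eq_iff (D : FlowData T f A)
    (hφ : ∀ t ∈ Icc (0 : ℝ) T, ∀ x, φ t x = (f t x : EReal)) {t : ℝ} (ht : t ∈ Icc (0 : ℝ) T)
    (x w : H) : psi φ A t x + conj (psi φ A t) (-(antisymmPart (A t) x) - w)
        = ((-(inner ℝ x w) : ℝ) : EReal) ↔
      -(A t x) - w ∈ subdiff (φ t) x := by
  rw [← inner_neg_antisymmPart_sub (A t), add_conj_eq_coe_inner_iff (psi_eq_coe A (hφ t ht)),
    subgradient_add_quadratic_iff (D.convex t ht) (D.pos t ht), mem_subdiff_iff (hφ t ht)]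

/-- Integrating the Fenchel bound gives `½(|u(0)|² - |u(T)|²)`; the `|u(T)|²` terms cancel and the
rest is a complete square. -/
theorem FlowData.coe_norm_sq_le_action (D : FlowData T f A)
    (hφ : ∀ t ∈ Icc (0 : ℝ) T, ∀ x, φ t x = (f t x : EReal)) (hT : 0 ≤ T) (u₀ : H) {u : ℝ → H}
    (hu : u ∈ A2 H T) : ((‖u 0 - u₀‖ ^ 2 : ℝ) : EReal) ≤ action T φ A u₀ u := by
  have hin : ∀ᵐ t ∂(volume.restrict (Icc (0 : ℝ) T)), t ∈ Icc (0 : ℝ) T :=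
    ae_restrict_mem measurableSet_Icc
  obtain ⟨h1, h2⟩ := A2.integral_inner_deriv hT hu
  have h3 := coe_integral_le_eintegral
    (hin.mono fun t ht => D.lagrangian_nonneg hφ ht (u t)
      (-(antisymmPart (A t) (u t)) - deriv u t)) h1
    (hin.mono fun t ht => FlowData.neg_inner_le_lagrangian hφ ht (u t) (deriv u t))
  refine le_trans (le_of_eq ?_) (add_le_add_right h3 _)
  rw [← EReal.coe_add, h2, norm_sub_sq_real]
  congr 1
  ring

theorem FlowData.action_eq_zero (D : FlowData T f A)
    (hφ : ∀ t ∈ Icc (0 : ℝ) T, ∀ x, φ t x = (f t x : EReal)) (hT : 0 ≤ T) {u₀ : H} {u : ℝ → H}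
    (hu : u ∈ A2 H T) (hs : IsSolution T φ A u₀ u) : action T φ A u₀ u = 0 := by
  have hin : ∀ᵐ t ∂(volume.restrict (Icc (0 : ℝ) T)), t ∈ Icc (0 : ℝ) T :=
    ae_restrict_mem measurableSet_Icc
  obtain ⟨h1, h2⟩ := A2.integral_inner_deriv hT hu
  have h3 := eintegral_eq_coe_integral
    (hin.mono fun t ht => D.lagrangian_nonneg hφ ht (u t)
      (-(antisymmPart (A t) (u t)) - deriv u t)) h1
    (by
      filter_upwards [hin, hs.1] with t ht hst
      exact (D.lagrangian_eq_iff hφ ht _ _).2 hst)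
  rw [action, h3, ← EReal.coe_add, h2, hs.2, real_inner_self_eq_norm_sq, ← EReal.coe_zero]
  congr 1
  ring

omit [CompleteSpace H] in
/-- The evolution is a contraction: solutions with the same initial value coincide. -/
theorem FlowData.solution_unique (D : FlowData T f A)
    (hφ : ∀ t ∈ Icc (0 : ℝ) T, ∀ x, φ t x = (f t x : EReal)) {u₀ : H} {u v : ℝ → H}
    (hu : u ∈ A2 H T) (hv : v ∈ A2 H T) (hus : IsSolution T φ A u₀ u)
    (hvs : IsSolution T φ A u₀ v) : EqOn u v (Icc (0 : ℝ) T) := by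
  intro t ht
  have hd : ∀ᵐ s ∂(volume.restrict (Icc (0 : ℝ) T)),
      HasDerivAt (u - v) (deriv u s - deriv v s) s := by
    filter_upwards [A2.hasDerivAt_deriv hu, A2.hasDerivAt_deriv hv] with s h1 h2 using h1.sub h2
  obtain ⟨h1, h2⟩ := norm_sq_sub_norm_sq_eq_integral (hu.1.sub hv.1) hd ht
  have h3 : ∫ s in (0 : ℝ)..t, 2 * (inner ℝ ((u - v) s) (deriv u s - deriv v s) : ℝ)
      ≤ ∫ s in (0 : ℝ)..t, (0 : ℝ) := by
    refine intervalIntegral.integral_mono_ae_restrict ht.1 h1 intervalIntegrable_const ?_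
    refine ae_restrict_of_ae_restrict_of_subset (Icc_subset_Icc_right ht.2) ?_
    filter_upwards [hus.1, hvs.1, ae_restrict_mem measurableSet_Icc] with s e1 e2 hs
    rw [mem_subdiff_iff (hφ s hs)] at e1 e2
    have e3 := e1 (v s)
    have e4 := e2 (u s)
    have e5 := D.pos s hs (u s - v s)
    rw [map_sub] at e5
    simp only [Pi.sub_apply, inner_sub_left, inner_sub_right, inner_neg_left] at e3 e4 e5 ⊢
    rw [real_inner_comm (deriv u s) (u s), real_inner_comm (deriv v s) (u s),
      real_inner_comm (deriv u s) (v s), real_inner_comm (deriv v s) (v s)]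
    linarith
  have h4 : ‖(u - v) 0‖ = 0 := by simp [hus.2, hvs.2]
  rw [intervalIntegral.integral_zero, ← h2, h4] at h3
  have h5 : ‖(u - v) t‖ ^ 2 ≤ 0 := by linarith
  have h6 : ‖(u - v) t‖ = 0 := pow_eq_zero_iff two_ne_zero |>.1 (le_antisymm h5 (sq_nonneg _))
  exact sub_eq_zero.1 (norm_eq_zero.1 h6)

variable [TopologicalSpace.SeparableSpace H]

/-- Needed to turn equality of integrals into equality a.e. -/
theorem FlowData.aemeasurable_lagrangian (D : FlowData T f A)
    (hφ : ∀ t ∈ Icc (0 : ℝ) T, ∀ x, φ t x = (f t x : EReal)) {u w : ℝ → H}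
    (hu : AEStronglyMeasurable u (volume.restrict (Icc (0 : ℝ) T)))
    (hw : AEStronglyMeasurable w (volume.restrict (Icc (0 : ℝ) T))) :
    AEMeasurable (fun t => psi φ A t (u t)
      + conj (psi φ A t) (-(antisymmPart (A t) (u t)) - w t))
      (volume.restrict (Icc (0 : ℝ) T)) := by
  have hin : ∀ᵐ t ∂(volume.restrict (Icc (0 : ℝ) T)), t ∈ Icc (0 : ℝ) T :=
    ae_restrict_mem measurableSet_Icc
  have hg : ∀ a : ℝ → H, AEStronglyMeasurable a (volume.restrict (Icc (0 : ℝ) T)) →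
      AEMeasurable (fun t => f t (a t) + 1 / 2 * (inner ℝ (A t (a t)) (a t) : ℝ))
        (volume.restrict (Icc (0 : ℝ) T)) := fun a ha =>
    ((D.aestronglyMeasurable_comp ha).add
      (((D.aestronglyMeasurable_op_comp ha).inner ha).const_mul (1 / 2))).aemeasurable
  have hc : ∀ z : H, AEMeasurable (fun t => (inner ℝ z (-(antisymmPart (A t) (u t)) - w t) : ℝ))
      (volume.restrict (Icc (0 : ℝ) T)) := by
    intro z
    have h1 : AEStronglyMeasurable (fun t => -(1 / 2 * ((inner ℝ (A t (u t)) z : ℝ)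
        - inner ℝ (A t z) (u t))) - inner ℝ (w t) z) (volume.restrict (Icc (0 : ℝ) T)) :=
      ((((D.aestronglyMeasurable_op_comp hu).inner aestronglyMeasurable_const).sub
        ((D.aestronglyMeasurable_op z).inner hu)).const_mul (1 / 2)).neg.sub
        (hw.inner aestronglyMeasurable_const)
    refine h1.aemeasurable.congr (Eventually.of_forall fun t => ?_)
    simp only
    rw [real_inner_comm (-(antisymmPart (A t) (u t)) - w t) z, inner_sub_left, inner_neg_left,
      inner_antisymmPart_left]
  refine AEMeasurable.add ?_ ?_
  · refine (hg u hu).coe_real_ereal.congr ?_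
    filter_upwards [hin] with t ht
    exact (psi_eq_coe A (hφ t ht) _).symm
  · have h2 : AEMeasurable (fun t => ⨆ k,
        (((inner ℝ (TopologicalSpace.denseSeq H k) (-(antisymmPart (A t) (u t)) - w t) : ℝ)
          - (f t (TopologicalSpace.denseSeq H k) + 1 / 2 * inner ℝ
            (A t (TopologicalSpace.denseSeq H k)) (TopologicalSpace.denseSeq H k)) : ℝ) : EReal))
        (volume.restrict (Icc (0 : ℝ) T)) :=
      AEMeasurable.iSup fun k =>
        ((hc _).sub (hg (fun _ => _) aestronglyMeasurable_const)).coe_real_ereal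
    refine h2.congr ?_
    filter_upwards [hin] with t ht
    have hcont := D.cont t ht
    exact (conj_eq_iSup_denseSeq (psi_eq_coe A (hφ t ht))
      (by fun_prop : Continuous fun x => f t x + 1 / 2 * (inner ℝ (A t x) x : ℝ)) _).symm

/-- The lower bound `|u(0) - u₀|²` forces the initial condition. What remains says that the Fenchel
inequality has no integrated slack, so it is an equality a.e. -/
theorem FlowData.isSolution_of_action_nonpos (D : FlowData T f A)
    (hφ : ∀ t ∈ Icc (0 : ℝ) T, ∀ x, φ t x = (f t x : EReal)) (hT : 0 ≤ T) {u₀ : H} {u : ℝ → H}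
    (hu : u ∈ A2 H T) (h : action T φ A u₀ u ≤ 0) : IsSolution T φ A u₀ u := by
  have hin : ∀ᵐ t ∂(volume.restrict (Icc (0 : ℝ) T)), t ∈ Icc (0 : ℝ) T :=
    ae_restrict_mem measurableSet_Icc
  have h0 : u 0 = u₀ := by
    have := (D.coe_norm_sq_le_action hφ hT u₀ hu).trans h
    rw [← EReal.coe_zero, EReal.coe_le_coe_iff] at this
    have h6 : ‖u 0 - u₀‖ = 0 := pow_eq_zero_iff two_ne_zero |>.1 (le_antisymm this (sq_nonneg _))
    exact sub_eq_zero.1 (norm_eq_zero.1 h6)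
  refine ⟨?_, h0⟩
  obtain ⟨h1, h2⟩ := A2.integral_inner_deriv hT hu
  have hle : eintegral T (fun t => psi φ A t (u t)
      + conj (psi φ A t) (-(antisymmPart (A t) (u t)) - deriv u t))
      ≤ ((∫ t in Icc (0 : ℝ) T, -(inner ℝ (u t) (deriv u t) : ℝ) : ℝ) : EReal) := by
    rw [action, h0, real_inner_self_eq_norm_sq, add_comm] at h
    have h3 := EReal.le_sub_iff_add_le (Or.inl (EReal.coe_ne_bot _))
      (Or.inl (EReal.coe_ne_top _)) |>.2 h
    refine h3.trans (le_of_eq ?_)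
    rw [← EReal.coe_zero, ← EReal.coe_sub, h2, h0]
    congr 1
    ring
  have h4 := ae_eq_of_eintegral_le
    (hin.mono fun t ht => D.lagrangian_nonneg hφ ht (u t)
      (-(antisymmPart (A t) (u t)) - deriv u t))
    (D.aemeasurable_lagrangian hφ (A2.aestronglyMeasurable hT hu) hu.2.2.1) h1
    (hin.mono fun t ht => FlowData.neg_inner_le_lagrangian hφ ht (u t) (deriv u t)) hle
  filter_upwards [h4, hin] with t e1 ht
  exact (D.lagrangian_eq_iff hφ ht _ _).1 e1

theorem FlowData.exists_isSolution (D : FlowData T f A)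
    (hφ : ∀ t ∈ Icc (0 : ℝ) T, ∀ x, φ t x = (f t x : EReal)) (hT : 0 ≤ T) (u₀ : H) :
    ∃ v ∈ A2 H T, IsSolution T φ A u₀ v := by
  obtain ⟨ξ, hξ, hs⟩ := D.exists_solution hT u₀
  have hξi : IntervalIntegrable ξ volume 0 T :=
    (intervalIntegrable_iff_integrableOn_Icc_of_le hT).2 (hξ.integrable (by norm_num))
  have hd := hasDerivAt_integral_ae hT u₀ hξi
  refine ⟨fun t => u₀ + ∫ s in (0 : ℝ)..t, ξ s,
    ⟨absolutelyContinuousOnInterval_integral u₀ hξi, hd.mono fun t ht => ht.differentiableAt,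
      hξ.ae_eq (hd.mono fun t ht => ht.deriv.symm)⟩, ?_, by simp⟩
  filter_upwards [hd, hs, ae_restrict_mem measurableSet_Icc] with t h1 h2 ht
  rw [mem_subdiff_iff (hφ t ht), h1.deriv]
  intro y
  have := h2 y
  rwa [neg_sub_comm] at this

end

end

end GradientFlow

/-! ### The theorem: existence and uniqueness of the minimizer and of the solution -/

theorem theorem6p4 {H : Type*} [NormedAddCommGroup H] [InnerProductSpace ℝ H] [CompleteSpace H]
    [TopologicalSpace.SeparableSpace H]
    (T : ℝ) (hT : 0 < T)
    (φ : ℝ → H → EReal) (A : ℝ → H →L[ℝ] H)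
    (hφ_meas : GradientFlow.LebesgueBorelMeasurable T φ)
    (hφ_convex : ∀ t ∈ Set.Icc (0 : ℝ) T, GradientFlow.ConvexFun (φ t))
    (hφ_lsc : ∀ t ∈ Set.Icc (0 : ℝ) T, LowerSemicontinuous (φ t))
    (hA_pos : ∀ t ∈ Set.Icc (0 : ℝ) T, ∀ x : H, 0 ≤ (inner ℝ (A t x) x : ℝ))
    (hA_meas : ∀ x y : H, AEMeasurable (fun t => (inner ℝ (A t x) y : ℝ))
      (MeasureTheory.volume.restrict (Set.Icc (0 : ℝ) T)))
    (hA_L2 : MeasureTheory.MemLp (fun t => ‖A t‖) 2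
      (MeasureTheory.volume.restrict (Set.Icc (0 : ℝ) T)))
    (p q : ℝ) (hp : 0 < p) (hq : 0 < q)
    (β γ : ℝ → ℝ)
    (hβ_pos : ∀ t ∈ Set.Icc (0 : ℝ) T, 0 < β t)
    (hγ_pos : ∀ t ∈ Set.Icc (0 : ℝ) T, 0 < γ t)
    (hβ : MeasureTheory.MemLp (fun t => (β t)⁻¹) ⊤
      (MeasureTheory.volume.restrict (Set.Icc (0 : ℝ) T)))
    (hγ : MeasureTheory.MemLp γ ⊤ (MeasureTheory.volume.restrict (Set.Icc (0 : ℝ) T)))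
    (hbounds : ∀ t ∈ Set.Icc (0 : ℝ) T, ∀ x : H,
      ((β t * ‖x‖ ^ p : ℝ) : EReal)
          ≤ φ t x + (((1 / 2 : ℝ) * inner ℝ (A t x) x : ℝ) : EReal) ∧
        φ t x + (((1 / 2 : ℝ) * inner ℝ (A t x) x : ℝ) : EReal)
          ≤ ((γ t * ‖x‖ ^ q : ℝ) : EReal))
    (u₀ : H) :
    ∃ v ∈ GradientFlow.A2 H T,
      IsMinOn (GradientFlow.action T φ A u₀) (GradientFlow.A2 H T) v ∧
      GradientFlow.action T φ A u₀ v = 0 ∧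
      (∀ u ∈ GradientFlow.A2 H T,
        IsMinOn (GradientFlow.action T φ A u₀) (GradientFlow.A2 H T) u →
          Set.EqOn u v (Set.Icc (0 : ℝ) T)) ∧
      GradientFlow.IsSolution T φ A u₀ v ∧
      (∀ u ∈ GradientFlow.A2 H T, GradientFlow.IsSolution T φ A u₀ u →
        Set.EqOn u v (Set.Icc (0 : ℝ) T)) := by
  have hreg := fun t (ht : t ∈ Set.Icc (0 : ℝ) T) => GradientFlow.regular_of_bounds
    (hφ_convex t ht) (hA_pos t ht) hp hq (hβ_pos t ht) (hγ_pos t ht) (hbounds t ht)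
  have D : GradientFlow.FlowData T (fun t x => (φ t x).toReal) A :=
    { convex := fun t ht => (hreg t ht).2.1
      cont := fun t ht => (hreg t ht).2.2.1
      zero := fun t ht => (hreg t ht).2.2.2.1
      nonneg := fun t ht => (hreg t ht).2.2.2.2.1
      bdd := by
        intro R
        -- The essential supremum of `γ` gives the bound on the ball of radius `R` for a.e. `t`.
        refine ⟨(MeasureTheory.eLpNorm γ ⊤
          (MeasureTheory.volume.restrict (Set.Icc (0 : ℝ) T))).toReal * R ^ q, ?_⟩
        filter_upwards [MeasureTheory.ae_le_eLpNormEssSup (f := γ)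
          (μ := MeasureTheory.volume.restrict (Set.Icc (0 : ℝ) T)),
          MeasureTheory.ae_restrict_mem measurableSet_Icc] with t h1 ht x hx
        have h2 : γ t ≤ (MeasureTheory.eLpNorm γ ⊤
            (MeasureTheory.volume.restrict (Set.Icc (0 : ℝ) T))).toReal := by
          have := ENNReal.toReal_mono hγ.2.ne
            (h1.trans_eq MeasureTheory.eLpNorm_exponent_top.symm)
          rw [toReal_enorm] at this
          exact (le_abs_self _).trans this
        exact ((hreg t ht).2.2.2.2.2 x).trans (mul_le_mul h2
          (Real.rpow_le_rpow (norm_nonneg x) hx hq.le) (by positivity) ENNReal.toReal_nonneg)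
      meas := fun x => (hφ_meas.aemeasurable x).ereal_toReal
      pos := hA_pos
      meas_op := hA_meas
      memLp_op := hA_L2 }
  have hφ : ∀ t ∈ Set.Icc (0 : ℝ) T, ∀ x, φ t x = ((φ t x).toReal : EReal) :=
    fun t ht => (hreg t ht).1
  obtain ⟨v, hv, hvs⟩ := D.exists_isSolution hφ hT.le u₀
  have hv0 := D.action_eq_zero hφ hT.le hv hvs
  refine ⟨v, hv, ?_, hv0, fun u hu hmin => ?_, hvs,
    fun u hu hus => D.solution_unique hφ hu hv hus hvs⟩
  · rw [isMinOn_iff]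
    intro u hu
    rw [hv0]
    refine le_trans ?_ (D.coe_norm_sq_le_action hφ hT.le u₀ hu)
    exact EReal.coe_nonneg.2 (by positivity)
  -- Any minimizer has action at most that of `v`, namely 0, hence is a solution; uniqueness of
  -- minimizers thus reduces to uniqueness of solutions.
  · refine D.solution_unique hφ hu hv (D.isSolution_of_action_nonpos hφ hT.le hu ?_) hvs
    rw [← hv0]
    exact isMinOn_iff.1 hmin v hv
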